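/- Let $d,\beta,\delta\ge 1$ be integers, let $R>0$ with $R^2>d$, and let $A>0$. On $[0,1]$ put $\varphi_1=1$, $\varphi_{2k}(t)=\sqrt2\cos(2\pi kt)$, $\varphi_{2k+1}(t)=\sqrt2\sin(2\pi kt)$ for $k\ge1$. For $j=(j_1,\dots,j_d)\in(\mathbb N^*)^d$ and $x\in[0,1]^d$ put $\varphi_j(x)=\prod_{m=1}^d\varphi_{j_m}(x_m)$ and $\theta_j(f)=\int_{[0,1]^d} f\varphi_j$. For a smoothness $s\ge1$ and a radius $r>0$, the Sobolev ball is $$\mathcal W^{s}(r)=\Big\{f\in L_2([0,1]^d):\ \sum_{j\in(\mathbb N^*)^d}\big(j_1^{2s}+\dots+j_d^{2s}\big)\,\theta_j(f)^2\le r^2\Big\}.$$ An $\alpha$-LDP mechanism $Q=(Q_1,\dots,Q_n)$ on $[0,1]^d$, with private views in a measurable space $\mathcal Z$, consists of Markov kernels $Q_i(\cdot\mid x_i,z_1,\dots,z_{i-1})$ on $\mathcal Z$ such that for all $i$, all $z_1,\dots,z_{i-1}\in\mathcal Z$, all $x,x'\in[0,1]^d$ and all measurable $B\subset\mathcal Z$,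 $$Q_i(B\mid x,z_1,\dots,z_{i-1})\le e^{\alpha}\,Q_i(B\mid x',z_1,\dots,z_{i-1}).$$ Let $X_1,\dots,X_n$ be i.i.d. with density $f$ on $[0,1]^d$, and let $Z_i\sim Q_i(\cdot\mid X_i,Z_1,\dots,Z_{i-1})$ successively for $i=1,\dots,n$. An estimator $\tilde f$ is a jointly measurable function of $(Z_1,\dots,Z_n)$ and of $x\in[0,1]^d$ that is integrable in $x$. The adversarial loss is $d_{\mathcal G}(\tilde f,f)=\sup_{g}\int_{[0,1]^d}(\tilde f-f)g$, the supremum being over the $g\in\mathcal G$ for which the product $(\tilde f-f)g$ is integrable (these are all $g\in\mathcal G=\mathcal W^\delta(1)$ if $\tilde f\in L_2([0,1]^d)$). Let $$\rho_n=\inf_{Q}\ \inf_{\tilde f}\ \sup_{f}\ \mathbb E_{f,Q}\big[d_{\mathcal W^{\delta}(1)}(\tilde f,f)\big]$$ be the minimax risk, with $Q$ ranging over all $\alpha$-LDP mechanisms, interactive or not, with any measurable space $\mathcal Z$, $\tilde f$ over all estimators based on $Z_1,\dots,Z_n$, and $f$ over all probability densities in $\mathcal W^{\beta}(R)$. Then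 there is a constant $c>0$ depending only on $A,d,\delta,\beta,R$ such that for every sample size $n$ and every $\alpha\in(0,A]$ with $n\alpha^2\ge1$, $$\rho_n\ \ge\ c\,\max\Big\{(n\alpha^2)^{-\frac{\beta+\delta}{2\beta+2d}},\ (n\alpha^2)^{-1/2}\Big\}.$$ -/

import Mathlib

open MeasureTheory ProbabilityTheory
open scoped ENNReal

universe u

/-- The unit cube `[0,1]^d`. Its `volume` is Lebesgue measure. -/
abbrev Cube (d : ℕ) : Type := Fin d → unitInterval

/-- The one-dimensional trigonometric basis: `φ₁ = 1`, `φ_{2k}(t) = √2 cos (2πkt)` and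
`φ_{2k+1}(t) = √2 sin (2πkt)` for `k ≥ 1`. -/
noncomputable def trigBasis (j : ℕ+) (t : ℝ) : ℝ :=
  if j = 1 then 1
  else if Even (j : ℕ) then
    Real.sqrt 2 * Real.cos (2 * Real.pi * (((j : ℕ) / 2 : ℕ) : ℝ) * t)
  else
    Real.sqrt 2 * Real.sin (2 * Real.pi * (((j : ℕ) / 2 : ℕ) : ℝ) * t)

/-- The tensor product basis `φ_j(x) = ∏ₘ φ_{jₘ}(xₘ)`. -/
noncomputable def cubeBasis {d : ℕ} (j : Fin d → ℕ+) (x : Cube d) : ℝ :=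
  ∏ m, trigBasis (j m) (x m : ℝ)

/-- The Fourier coefficient `θ_j(f) = ∫ f φ_j`. -/
noncomputable def fourierCoefficient {d : ℕ} (f : Cube d → ℝ) (j : Fin d → ℕ+) : ℝ :=
  ∫ x, f x * cubeBasis j x

/-- The term `(j₁^{2β} + … + j_d^{2β}) θ_j(f)²` of the Sobolev series. -/
noncomputable def sobolevTerm {d : ℕ} (β : ℕ) (f : Cube d → ℝ) (j : Fin d → ℕ+) : ℝ :=
  (∑ m, ((j m : ℕ) : ℝ) ^ (2 * β)) * fourierCoefficient f j ^ 2

/-- The isotropic Sobolev ball `W^β(R)`, for an integer smoothness `β`. -/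
def sobolevBall (d β : ℕ) (R : ℝ) : Set (Cube d → ℝ) :=
  {f | MemLp f 2 volume ∧ Summable (sobolevTerm β f) ∧ ∑' j, sobolevTerm β f j ≤ R ^ 2}

/-- Probability densities with respect to Lebesgue measure on the cube. -/
def densities (d : ℕ) : Set (Cube d → ℝ) :=
  {f | Measurable f ∧ (∀ x, 0 ≤ f x) ∧ Integrable f volume ∧ ∫ x, f x = 1}

/-- The probability distribution with density `f`. -/
noncomputable def densityLaw {d : ℕ} (f : Cube d → ℝ) : Measure (Cube d) :=
  volume.withDensity fun x => ENNReal.ofReal (f x)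

/-- A sequentially interactive mechanism for `n` individuals with data in `X` and private views
in `Z`: the `i`-th channel gives the law of the `i`-th view given the `i`-th datum and the
previous views. -/
structure Mechanism (n : ℕ) (X : Type*) [MeasurableSpace X] (Z : Type u) [MeasurableSpace Z] where
  /-- the channels -/
  channel : (i : Fin n) → Kernel (X × (Fin i → Z)) Z
  isMarkov : ∀ i, IsMarkovKernel (channel i)

/-- `α`-local differential privacy: every ratio of the probabilities of an event under two values
of the datum, given the same previous views, is at most `e^α`. -/
def Mechanism.IsLDP {n : ℕ} {X : Type*} [MeasurableSpace X] {Z : Type u} [MeasurableSpace Z]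
    (Q : Mechanism n X Z) (α : ℝ) : Prop :=
  ∀ (i : Fin n) (z : Fin i → Z) (x x' : X) (B : Set Z), MeasurableSet B →
    Q.channel i (x, z) B ≤ ENNReal.ofReal (Real.exp α) * Q.channel i (x', z) B

/-- Given the data and views `h` of the first `k` individuals, the law of the pair (datum, view) of
the next one: the datum has law `P` independently of `h`, and the view is drawn from the channel
`K` given this datum and the views in `h`. -/
noncomputable def stepKernel {k : ℕ} {X : Type*} [MeasurableSpace X] {Z : Type u}
    [MeasurableSpace Z] (P : Measure X) (K : Kernel (X × (Fin k → Z)) Z) :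
    Kernel (Fin k → X × Z) (X × Z) :=
  Kernel.compProd (Kernel.const (Fin k → X × Z) P)
    (K.comap (fun p : (Fin k → X × Z) × X => (p.2, fun i => (p.1 i).2)) (by fun_prop))

/-- The joint law of `(X₁, Z₁), …, (X_k, Z_k)` for the first `k` of the `n` individuals, when the
data are i.i.d. with law `P` and the views are drawn from `Q`. -/
noncomputable def Mechanism.jointLaw {n : ℕ} {X : Type*} [MeasurableSpace X] {Z : Type u}
    [MeasurableSpace Z] (Q : Mechanism n X Z) (P : Measure X) :
    (k : ℕ) → k ≤ n → Measure (Fin k → X × Z)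
  | 0, _ => Measure.dirac Fin.elim0
  | k + 1, hk =>
      ((Q.jointLaw P k (Nat.le_of_succ_le hk)).compProd
        (stepKernel P (Q.channel ⟨k, hk⟩))).map
          (fun p => (Fin.snoc p.1 p.2 : Fin (k + 1) → X × Z))

/-- The law of the private views `(Z₁, …, Z_n)`. -/
noncomputable def Mechanism.viewLaw {n : ℕ} {X : Type*} [MeasurableSpace X] {Z : Type u}
    [MeasurableSpace Z] (Q : Mechanism n X Z) (P : Measure X) : Measure (Fin n → Z) :=
  (Q.jointLaw P n le_rfl).map (fun h i => (h i).2)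

/-- An estimator of a function on the cube based on `n` private views. Integrability over the cube
is what it takes for the loss to make sense, as the discriminators include constant functions. -/
structure Estimator (n d : ℕ) (Z : Type u) [MeasurableSpace Z] where
  /-- the estimate `f̃(x)` computed from the views `z` -/
  toFun : (Fin n → Z) → Cube d → ℝ
  measurable_uncurry : Measurable (Function.uncurry toFun)
  integrable : ∀ z, Integrable (toFun z) volume

/-- The adversarial loss `sup_{g ∈ G} ∫ (f₁ - f₂) g`, with values in `[0,∞]`. The discriminator
classes considered contain `0`, so that replacing negative integrals by `0` changes nothing, and
neither does a `g` whose product with `f₁ - f₂` is not integrable: it contributes `0`. -/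
noncomputable def adversarialLoss {d : ℕ} (G : Set (Cube d → ℝ)) (f₁ f₂ : Cube d → ℝ) : ℝ≥0∞ :=
  ⨆ g ∈ G, ENNReal.ofReal (∫ x, (f₁ x - f₂ x) * g x)

/-- The worst case over `f ∈ F` of the expected loss `E_{f,Q} d_G(f̃, f)`. -/
noncomputable def maximalRisk {n d : ℕ} {Z : Type u} [MeasurableSpace Z]
    (F G : Set (Cube d → ℝ)) (Q : Mechanism n (Cube d) Z) (E : Estimator n d Z) : ℝ≥0∞ :=
  ⨆ f ∈ F, ∫⁻ z, adversarialLoss G (E.toFun z) f ∂(Q.viewLaw (densityLaw f))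

/-- The minimax risk: the infimum of the maximal risk over all measurable spaces of private views,
all `α`-LDP mechanisms and all estimators. -/
noncomputable def minimaxRisk (n d : ℕ) (F G : Set (Cube d → ℝ)) (α : ℝ) : ℝ≥0∞ :=
  ⨅ (Z : Type u) (_ : MeasurableSpace Z) (Q : Mechanism n (Cube d) Z) (_ : Q.IsLDP α)
    (E : Estimator n d Z), maximalRisk F G Q E

/-!
The minimax risk is bounded from below by Assouad's lemma over perturbations of the uniform density.

*Perturbations.* For `K ≥ 1`, the `K ^ d` functions `cubeBump i₀ k` are tensor products of Fejér
kernels translated to the nodes `k / K` of a grid, modulated at frequency `2 K` in the coordinate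
`i₀`. They are trigonometric polynomials with frequencies below `3 K` and with mean zero, so Bessel's
inequality alone puts their combinations with bounded sup norm into Sobolev balls
(`IsBandLimited.affine_mem_sobolevBall`). As `∑ₖ |cubeBump i₀ k| ≤ 1`, all the functions
`1 + ε ∑ₖ ± cubeBump i₀ k` with `ε ≤ 1` are densities, whatever the smoothness; for `ε` of order
`K ^ (-β)` they lie in the ball of the densities, and the discriminators of order `K ^ (-δ)` times a
signed sum of bumps lie in the ball of the discriminators. The bumps are not orthogonal, but Assouad's
lemma only uses what flipping a single sign does: the scalar product with the bump of index `k`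
changes by `2 ε` times the squared norm of this bump, which is at least of order `K ^ (-d)`.

*Privacy.* Two densities that differ in one sign are at distance at most `2 ε K ^ (-d)` in
`L¹`. Let `s` be this distance times `e^α - e^(-α)`. Then `(∫ g dV')² ≤ (1 + s²)ⁿ ∫ g² dV` for the
laws `V`, `V'` of the views and all bounded `g`. For a single channel
(`sq_integral_channel_le`), one centres `g` and observes that the channel integrates the centred
function `u` to at most `(e^α - e^(-α)) ∫ |u|`, uniformly in the datum; conditioning on the past then
gives the result by induction on the number of individuals. This form of the chi-square bound needs no
likelihood ratios, hence no assumption on the space of views. When `n s² ≤ 1 / 2`, it gives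
`V'(B)² ≤ 2 V(B)` for all events `B`, so that the two laws cannot be told apart.

*Rates.* The outcome is a lower bound of order `ε K ^ (-δ)` whenever `ε K ^ β` and
`n α² ε² K ^ (-2 d)` are small (`exists_le_minimaxRisk`). The first rate is obtained with `K` of order
`(n α²) ^ (1 / (2 β + 2 d))` and `ε` of order `K ^ (-β)`, the second one with `K = 1` and `ε` of order
`(n α²) ^ (-1 / 2)`.
-/

/-! ### Trigonometric integrals and Fejér bumps on the unit interval -/

theorem integral_unitInterval (g : ℝ → ℝ) :
    ∫ x : unitInterval, g x = ∫ t in (0 : ℝ)..1, g t := by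
  rw [intervalIntegral.integral_of_le zero_le_one, ← integral_Icc_eq_integral_Ioc]
  exact integral_subtype_comap measurableSet_Icc g

theorem integral_cos_int (a : ℤ) (b : ℝ) :
    ∫ t in (0 : ℝ)..1, Real.cos (2 * Real.pi * a * t + b) = if a = 0 then Real.cos b else 0 := by
  split_ifs with h
  · simp [h]
  · have ha : 2 * Real.pi * (a : ℝ) ≠ 0 := by
      have : (a : ℝ) ≠ 0 := by exact_mod_cast h
      positivity
    rw [intervalIntegral.integral_comp_mul_add Real.cos ha, integral_cos]
    have : Real.sin (2 * Real.pi * a * 1 + b) = Real.sin (2 * Real.pi * a * 0 + b) := by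
      rw [show 2 * Real.pi * a * 1 + b = 2 * Real.pi * a * 0 + b + a * (2 * Real.pi) by ring,
        Real.sin_add_int_mul_two_pi]
    rw [this, sub_self, smul_zero]

theorem cos_mul_cos (x y : ℝ) :
    Real.cos x * Real.cos y = (Real.cos (x + y) + Real.cos (x - y)) / 2 := by
  rw [Real.cos_add, Real.cos_sub]; ring

theorem integral_cos_mul_cos (a c : ℤ) (b e : ℝ) :
    ∫ t in (0 : ℝ)..1, Real.cos (2 * Real.pi * a * t + b) * Real.cos (2 * Real.pi * c * t + e) =
      ((if a + c = 0 then Real.cos (b + e) else 0) +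
        (if a - c = 0 then Real.cos (b - e) else 0)) / 2 := by
  rw [← integral_cos_int, ← integral_cos_int, ← intervalIntegral.integral_add,
    ← intervalIntegral.integral_div]
  · congr 1 with t
    rw [cos_mul_cos]
    push_cast
    ring_nf
  all_goals exact Continuous.intervalIntegrable (by fun_prop) _ _

theorem integral_cos_mul_cos_mul_cos {a c l : ℤ} (h : |a| < |(|l| - |c|)|) (b e : ℝ) :
    ∫ t in (0 : ℝ)..1, Real.cos (2 * Real.pi * a * t + b) * Real.cos (2 * Real.pi * c * t) *
      Real.cos (2 * Real.pi * l * t + e) = 0 := by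
  have key : ∀ t : ℝ, Real.cos (2 * Real.pi * a * t + b) * Real.cos (2 * Real.pi * c * t) *
      Real.cos (2 * Real.pi * l * t + e) =
      (Real.cos (2 * Real.pi * (a + c : ℤ) * t + b) * Real.cos (2 * Real.pi * l * t + e)) / 2 +
      (Real.cos (2 * Real.pi * (a - c : ℤ) * t + b) * Real.cos (2 * Real.pi * l * t + e)) / 2 := by
    intro t
    rw [cos_mul_cos (2 * Real.pi * a * t + b)]
    push_cast
    ring_nf
  simp_rw [key]
  rw [intervalIntegral.integral_add, intervalIntegral.integral_div, intervalIntegral.integral_div,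
    integral_cos_mul_cos, integral_cos_mul_cos, if_neg, if_neg, if_neg, if_neg]
  · simp
  any_goals (intro h0; grind)
  all_goals exact Continuous.intervalIntegrable (by fun_prop) _ _

/-- The Fejér kernel of degree less than `K`, translated by `k / K` and divided by `K`: a
nonnegative trigonometric polynomial concentrated on an interval of length of order `1 / K` about
`k / K`. -/
noncomputable def fejerBump (K k : ℕ) (t : ℝ) : ℝ :=
  ((∑ i ∈ Finset.range K, Real.cos (2 * Real.pi * i * (t - k / K))) ^ 2 +
    (∑ i ∈ Finset.range K, Real.sin (2 * Real.pi * i * (t - k / K))) ^ 2) / K ^ 2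

theorem fejerBump_nonneg (K k : ℕ) (t : ℝ) : 0 ≤ fejerBump K k t := by
  unfold fejerBump; positivity

@[fun_prop]
theorem continuous_fejerBump (K k : ℕ) : Continuous (fejerBump K k) := by
  unfold fejerBump; fun_prop

theorem fejerBump_eq_sum (K k : ℕ) (t : ℝ) :
    fejerBump K k t = (∑ i ∈ Finset.range K, ∑ j ∈ Finset.range K,
      Real.cos (2 * Real.pi * ((i : ℤ) - j : ℤ) * t +
        -(2 * Real.pi * ((i : ℤ) - j : ℤ) * k / K))) / K ^ 2 := by
  rw [fejerBump, sq, sq, Finset.sum_mul_sum, Finset.sum_mul_sum, ← Finset.sum_add_distrib]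
  congr 1
  refine Finset.sum_congr rfl fun i _ => ?_
  rw [← Finset.sum_add_distrib]
  refine Finset.sum_congr rfl fun j _ => ?_
  rw [← Real.cos_sub]
  congr 1
  push_cast
  ring

theorem integral_fejerBump {K : ℕ} (hK : 1 ≤ K) (k : ℕ) :
    ∫ t in (0 : ℝ)..1, fejerBump K k t = 1 / K := by
  have hK0 : (K : ℝ) ≠ 0 := by positivity
  simp_rw [fejerBump_eq_sum]
  rw [intervalIntegral.integral_div, intervalIntegral.integral_finsetSum]
  · have : ∀ i ∈ Finset.range K, ∫ t in (0 : ℝ)..1, ∑ j ∈ Finset.range K,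
        Real.cos (2 * Real.pi * ((i : ℤ) - j : ℤ) * t +
          -(2 * Real.pi * ((i : ℤ) - j : ℤ) * k / K)) = 1 := by
      intro i hi
      rw [intervalIntegral.integral_finsetSum]
      · simp_rw [integral_cos_int]
        rw [Finset.sum_eq_single i]
        · simp
        · intro j _ hj
          rw [if_neg (by omega)]
        · exact fun h => absurd hi h
      · intro j _
        exact Continuous.intervalIntegrable (by fun_prop) _ _
    rw [Finset.sum_congr rfl this]
    simp
    field_simp
  · intro j _
    exact Continuous.intervalIntegrable (by fun_prop) _ _

/-- The cosines at `K` equispaced phases sum to zero, by telescoping. -/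
theorem sum_cos_equispaced {K : ℕ} {a : ℤ} (ha : a ≠ 0) (haK : |a| < K) (θ : ℝ) :
    ∑ k ∈ Finset.range K, Real.cos (θ + -(2 * Real.pi * a * k / K)) = 0 := by
  have hK : (0 : ℝ) < K := by
    have : (0 : ℤ) < K := lt_of_le_of_lt (abs_nonneg a) haK
    exact_mod_cast this
  have hs : Real.sin (Real.pi * a / K) ≠ 0 := by
    intro h
    obtain ⟨m, hm⟩ := Real.sin_eq_zero_iff.mp h
    have h1 : (m : ℝ) * K = a := by
      field_simp at hm
      linarith
    have h2 : m * K = a := by exact_mod_cast h1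
    have hm0 : m ≠ 0 := by rintro rfl; simp at h2; exact ha h2.symm
    have : (K : ℤ) ≤ |a| := by
      rw [← h2, abs_mul, Nat.abs_cast]
      exact le_mul_of_one_le_left (by positivity) (Int.one_le_abs hm0)
    omega
  have key : ∀ k : ℕ, 2 * Real.sin (Real.pi * a / K) * Real.cos (θ + -(2 * Real.pi * a * k / K)) =
      Real.sin (θ - 2 * Real.pi * a * k / K + Real.pi * a / K) -
        Real.sin (θ - 2 * Real.pi * a * (k + 1 : ℕ) / K + Real.pi * a / K) := by
    intro k
    rw [show θ - 2 * Real.pi * a * (k + 1 : ℕ) / K + Real.pi * a / K =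
      (θ + -(2 * Real.pi * a * k / K)) - Real.pi * a / K by push_cast; field_simp; ring,
      show θ - 2 * Real.pi * a * k / K + Real.pi * a / K =
      (θ + -(2 * Real.pi * a * k / K)) + Real.pi * a / K by ring, Real.sin_add, Real.sin_sub]
    ring
  have h0 : 2 * Real.sin (Real.pi * a / K) *
      ∑ k ∈ Finset.range K, Real.cos (θ + -(2 * Real.pi * a * k / K)) = 0 := by
    rw [Finset.mul_sum, Finset.sum_congr rfl fun k _ => key k,
      Finset.sum_range_sub' fun k : ℕ =>
        Real.sin (θ - 2 * Real.pi * a * k / K + Real.pi * a / K)]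
    rw [show θ - 2 * Real.pi * a * K / K + Real.pi * a / K =
      θ - 2 * Real.pi * a * (0 : ℕ) / K + Real.pi * a / K - a * (2 * Real.pi) by
        field_simp; simp; ring, Real.sin_sub_int_mul_two_pi, sub_self]
  simpa [hs] using h0

theorem sum_fejerBump {K : ℕ} (hK : 1 ≤ K) (t : ℝ) :
    ∑ k ∈ Finset.range K, fejerBump K k t = 1 := by
  have hK0 : (K : ℝ) ≠ 0 := by positivity
  simp_rw [fejerBump_eq_sum]
  rw [← Finset.sum_div, Finset.sum_comm]
  have : ∀ i ∈ Finset.range K, ∑ k ∈ Finset.range K, ∑ j ∈ Finset.range K,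
      Real.cos (2 * Real.pi * ((i : ℤ) - j : ℤ) * t +
        -(2 * Real.pi * ((i : ℤ) - j : ℤ) * k / K)) = K := by
    intro i hi
    rw [Finset.sum_comm, Finset.sum_eq_single i]
    · simp
    · intro j hj hji
      rw [Finset.mem_range] at hi hj
      exact sum_cos_equispaced (by omega) (by rw [abs_lt]; omega) _
    · exact fun h => absurd hi h
  rw [Finset.sum_congr rfl this]
  simp
  field_simp

/-- The Fejér bump modulated at frequency `c` has frequencies at distance less than `K` from `c`. -/
theorem integral_fejerBump_mul_cos_mul_cos {K : ℕ} (k : ℕ) {c l : ℕ}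
    (h : (K : ℤ) ≤ |(l : ℤ) - c|) (e : ℝ) :
    ∫ t in (0 : ℝ)..1, fejerBump K k t * Real.cos (2 * Real.pi * c * t) *
      Real.cos (2 * Real.pi * l * t + e) = 0 := by
  simp_rw [fejerBump_eq_sum, div_mul_eq_mul_div, Finset.sum_mul]
  rw [intervalIntegral.integral_div, intervalIntegral.integral_finsetSum]
  · rw [Finset.sum_eq_zero, zero_div]
    intro i hi
    rw [intervalIntegral.integral_finsetSum]
    · refine Finset.sum_eq_zero fun j hj => ?_
      rw [Finset.mem_range] at hi hj
      have := integral_cos_mul_cos_mul_cos (a := (i : ℤ) - j) (c := c) (l := l) (by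
        rw [Nat.abs_cast, Nat.abs_cast]
        refine lt_of_lt_of_le ?_ h
        rw [abs_lt]; omega) (-(2 * Real.pi * ((i : ℤ) - j : ℤ) * k / K)) e
      simpa using this
    · intro j _
      exact Continuous.intervalIntegrable (by fun_prop) _ _
  · intro j _
    exact Continuous.intervalIntegrable (by fun_prop) _ _

/-- Both factors are bounded below on an interval of length `1 / (12 K)` to the right of
`k / K`. -/
theorem le_integral_sq_fejerBump_mul_cos {K : ℕ} {k e : ℕ} (hk : k < K) (he : e ≤ 2) :
    1 / (768 * (K : ℝ)) ≤
      ∫ t in (0 : ℝ)..1, (fejerBump K k t * Real.cos (2 * Real.pi * (e * K : ℕ) * t)) ^ 2 := by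
  have hK : (1 : ℝ) ≤ K := by exact_mod_cast (by omega : 1 ≤ K)
  have hK0 : (0 : ℝ) < K := by linarith
  have hkK : (k : ℝ) + 1 ≤ K := by exact_mod_cast hk
  set a : ℝ := k / K with ha
  have ha0 : 0 ≤ a := by positivity
  have hlen : 0 < 1 / (12 * (K : ℝ)) := by positivity
  have hb1 : a + 1 / (12 * K) ≤ 1 := by
    rw [ha, div_add_div _ _ hK0.ne' (by positivity), div_le_one (by positivity)]
    nlinarith
  have hpt : ∀ t ∈ Set.Icc a (a + 1 / (12 * (K : ℝ))),
      1 / 64 ≤ (fejerBump K k t * Real.cos (2 * Real.pi * (e * K : ℕ) * t)) ^ 2 := by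
    intro t ht
    obtain ⟨s, rfl⟩ : ∃ s, t = a + s := ⟨t - a, by ring⟩
    have hs0 : 0 ≤ s := by linarith [ht.1]
    have hs1 : s * K ≤ 1 / 12 := by
      have : s ≤ 1 / (12 * (K : ℝ)) := by linarith [ht.2]
      calc s * K ≤ 1 / (12 * (K : ℝ)) * K := by gcongr
        _ = 1 / 12 := by field_simp
    have hcos : ∀ u : ℝ, 0 ≤ u → u ≤ 1 / 6 → 1 / 2 ≤ Real.cos (2 * Real.pi * u) := by
      intro u hu0 hu1
      rw [← Real.cos_pi_div_three]
      have := Real.pi_pos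
      apply Real.cos_le_cos_of_nonneg_of_le_pi (by positivity) (by linarith) (by nlinarith)
    have h1 : (1 : ℝ) / 2 ≤ Real.cos (2 * Real.pi * (e * K : ℕ) * (a + s)) := by
      rw [show 2 * Real.pi * (e * K : ℕ) * (a + s) =
        2 * Real.pi * (e * (s * K)) + ((e * k : ℕ) : ℤ) * (2 * Real.pi) by
          rw [ha]; push_cast; field_simp; ring, Real.cos_add_int_mul_two_pi]
      have he' : (e : ℝ) ≤ 2 := by exact_mod_cast he
      exact hcos _ (by positivity) (by nlinarith [mul_nonneg hs0 hK0.le])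
    have h2 : (1 : ℝ) / 4 ≤ fejerBump K k (a + s) := by
      have h3 : (K : ℝ) * (1 / 2) ≤
          ∑ i ∈ Finset.range K, Real.cos (2 * Real.pi * i * (a + s - k / K)) := by
        have : ∑ i ∈ Finset.range K, (1 / 2 : ℝ) = K * (1 / 2) := by simp
        rw [← this]
        refine Finset.sum_le_sum fun i hi => ?_
        have hi' : (i : ℝ) ≤ K := by exact_mod_cast (Finset.mem_range.mp hi).le
        rw [← ha, add_sub_cancel_left, mul_assoc]
        exact hcos _ (by positivity) (by nlinarith)
      rw [fejerBump, le_div_iff₀ (by positivity)]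
      nlinarith [sq_nonneg (∑ i ∈ Finset.range K, Real.sin (2 * Real.pi * i * (a + s - k / K)))]
    nlinarith [mul_le_mul h2 h1 (by norm_num) (by linarith)]
  calc 1 / (768 * (K : ℝ)) = ∫ t in a..(a + 1 / (12 * (K : ℝ))), (1 / 64 : ℝ) := by
        rw [intervalIntegral.integral_const, smul_eq_mul]; field_simp; norm_num
    _ ≤ ∫ t in a..(a + 1 / (12 * (K : ℝ))),
          (fejerBump K k t * Real.cos (2 * Real.pi * (e * K : ℕ) * t)) ^ 2 :=
        intervalIntegral.integral_mono_on (by linarith) (by simp)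
          (Continuous.intervalIntegrable (by fun_prop) _ _) hpt
    _ ≤ _ := intervalIntegral.integral_mono_interval ha0 (by linarith) hb1
          (ae_of_all _ fun t => sq_nonneg _) (Continuous.intervalIntegrable (by fun_prop) _ _)

/-! ### Fourier coefficients on the cube -/

theorem Continuous.integrable_cube {d : ℕ} {f : Cube d → ℝ} (hf : Continuous f) :
    Integrable f volume :=
  hf.integrable_of_hasCompactSupport (HasCompactSupport.of_compactSpace f)

theorem integral_cube_prod {d : ℕ} (g : Fin d → ℝ → ℝ) :
    ∫ x : Cube d, ∏ m, g m (x m) = ∏ m, ∫ t in (0 : ℝ)..1, g m t := by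
  rw [integral_fintype_prod_volume_eq_prod fun (m : Fin d) (t : unitInterval) => g m t]
  simp_rw [integral_unitInterval]

/-- Every basis function is a cosine with an amplitude and a phase. -/
theorem exists_trigBasis_eq_cos (j : ℕ+) : ∃ c b : ℝ,
    (∀ t, trigBasis j t = c * Real.cos (2 * Real.pi * ((j : ℕ) / 2 : ℕ) * t + b)) ∧
      ((j = 1 ∧ c = 1 ∧ b = 0) ∨ (j ≠ 1 ∧ Even (j : ℕ) ∧ c = √2 ∧ b = 0) ∨
        (j ≠ 1 ∧ ¬ Even (j : ℕ) ∧ c = √2 ∧ b = -(Real.pi / 2))) := by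
  by_cases h1 : j = 1
  · exact ⟨1, 0, fun t => by simp [trigBasis, h1], by simp [h1]⟩
  by_cases h2 : Even (j : ℕ)
  · exact ⟨√2, 0, fun t => by simp [trigBasis, h1, h2], by simp [h1, h2]⟩
  · exact ⟨√2, -(Real.pi / 2), fun t => by
      rw [trigBasis, if_neg h1, if_neg h2, ← sub_eq_add_neg, Real.cos_sub_pi_div_two],
      by simp [h1, h2]⟩

@[fun_prop]
theorem continuous_trigBasis (j : ℕ+) : Continuous (trigBasis j) := by
  obtain ⟨c, b, h, -⟩ := exists_trigBasis_eq_cos j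
  rw [funext h]
  fun_prop

@[fun_prop]
theorem continuous_cubeBasis {d : ℕ} (j : Fin d → ℕ+) : Continuous (cubeBasis j) := by
  unfold cubeBasis; fun_prop

theorem integral_trigBasis_mul (i j : ℕ+) :
    ∫ t in (0 : ℝ)..1, trigBasis i t * trigBasis j t = if i = j then 1 else 0 := by
  have h2 : √2 * √2 = 2 := Real.mul_self_sqrt (by norm_num)
  obtain ⟨c, b, h, hc⟩ := exists_trigBasis_eq_cos i
  obtain ⟨c', b', h', hc'⟩ := exists_trigBasis_eq_cos j
  have hint : ∫ t in (0 : ℝ)..1, trigBasis i t * trigBasis j t = c * c' *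
      (((if (((i : ℕ) / 2 : ℕ) : ℤ) + ((j : ℕ) / 2 : ℕ) = 0 then Real.cos (b + b') else 0) +
        (if (((i : ℕ) / 2 : ℕ) : ℤ) - ((j : ℕ) / 2 : ℕ) = 0 then Real.cos (b - b') else 0)) / 2) := by
    rw [← integral_cos_mul_cos, ← intervalIntegral.integral_const_mul]
    congr 1 with t
    rw [h, h', Int.cast_natCast, Int.cast_natCast]
    ring
  rw [hint]
  have hi := i.pos
  have hj := j.pos
  by_cases hij : i = j
  · subst hij
    rw [if_pos rfl]
    rcases hc with ⟨h1, rfl, rfl⟩ | ⟨h1, h1', rfl, rfl⟩ | ⟨h1, h1', rfl, rfl⟩ <;>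
    rcases hc' with ⟨h3, rfl, rfl⟩ | ⟨h3, h3', rfl, rfl⟩ | ⟨h3, h3', rfl, rfl⟩ <;>
      first
      | contradiction
      | simp [h1]
    all_goals
      have : (i : ℕ) ≠ 1 := fun h => h1 (PNat.coe_inj.mp h)
      rw [if_neg (by omega)]
      simp
  · have hij' : (i : ℕ) ≠ j := fun h => hij (PNat.coe_inj.mp h)
    rw [if_neg hij]
    have e1 : ∀ i : ℕ+, i = 1 ↔ (i : ℕ) = 1 := fun i => by rw [← PNat.coe_inj]; rfl
    simp only [e1, ne_eq, Nat.even_iff] at hc hc'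
    by_cases hd : (((i : ℕ) / 2 : ℕ) : ℤ) - ((j : ℕ) / 2 : ℕ) = 0
    · rw [if_pos hd, if_neg (by omega)]
      rcases hc with ⟨h1, rfl, rfl⟩ | ⟨h1, h1', rfl, rfl⟩ | ⟨h1, h1', rfl, rfl⟩ <;>
      rcases hc' with ⟨h3, rfl, rfl⟩ | ⟨h3, h3', rfl, rfl⟩ | ⟨h3, h3', rfl, rfl⟩ <;>
        first
        | omega
        | simp
    · rw [if_neg hd, if_neg (by omega)]
      simp

theorem integral_cubeBasis_mul {d : ℕ} (i j : Fin d → ℕ+) :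
    ∫ x, cubeBasis i x * cubeBasis j x = if i = j then 1 else 0 := by
  simp_rw [cubeBasis, ← Finset.prod_mul_distrib]
  rw [integral_cube_prod fun m t => trigBasis (i m) t * trigBasis (j m) t]
  simp_rw [integral_trigBasis_mul]
  split_ifs with h
  · simp [h]
  · obtain ⟨m, hm⟩ := Function.ne_iff.mp h
    exact Finset.prod_eq_zero (Finset.mem_univ m) (if_neg hm)

theorem fourierCoefficient_cubeBasis {d : ℕ} (i j : Fin d → ℕ+) :
    fourierCoefficient (cubeBasis i) j = if i = j then 1 else 0 :=
  integral_cubeBasis_mul i j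

theorem cubeBasis_one {d : ℕ} (x : Cube d) : cubeBasis (fun _ => 1) x = 1 := by
  simp [cubeBasis, trigBasis]

theorem fourierCoefficient_one {d : ℕ} (j : Fin d → ℕ+) :
    fourierCoefficient (fun _ => 1) j = if j = fun _ => 1 then 1 else 0 := by
  have := integral_cubeBasis_mul (fun _ => 1) j
  simp only [cubeBasis_one] at this
  rw [fourierCoefficient, this]
  simp [eq_comm]

theorem fourierCoefficient_add_mul {d : ℕ} {f h : Cube d → ℝ} (hf : Continuous f)
    (hh : Continuous h) (a : ℝ) (j : Fin d → ℕ+) :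
    fourierCoefficient (fun x => f x + a * h x) j =
      fourierCoefficient f j + a * fourierCoefficient h j := by
  rw [fourierCoefficient, fourierCoefficient, fourierCoefficient, ← integral_const_mul,
    ← integral_add (Continuous.integrable_cube (by fun_prop))
      (Continuous.integrable_cube (by fun_prop))]
  congr 1 with x
  ring

/-- Bessel's inequality. -/
theorem sum_fourierCoefficient_sq_le {d : ℕ} {h : Cube d → ℝ} (hh : Continuous h)
    (S : Finset (Fin d → ℕ+)) : ∑ j ∈ S, fourierCoefficient h j ^ 2 ≤ ∫ x, h x ^ 2 := by
  set p : Cube d → ℝ := fun x => ∑ j ∈ S, fourierCoefficient h j * cubeBasis j x with hp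
  have hpc : Continuous p := by fun_prop
  have hmul : ∀ u : Cube d → ℝ, Continuous u →
      ∫ x, u x * p x = ∑ j ∈ S, fourierCoefficient h j * fourierCoefficient u j := by
    intro u hu
    simp_rw [hp, Finset.mul_sum]
    rw [integral_finsetSum _ fun j _ => Continuous.integrable_cube (by fun_prop)]
    refine Finset.sum_congr rfl fun j _ => ?_
    rw [fourierCoefficient, fourierCoefficient, ← integral_const_mul]
    congr 1 with x
    ring
  have hcoef : ∀ j ∈ S, fourierCoefficient p j = fourierCoefficient h j := by
    intro j hj
    have : fourierCoefficient p j = ∫ x, cubeBasis j x * p x := by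
      rw [fourierCoefficient]; congr 1 with x; ring
    rw [this, hmul _ (by fun_prop), Finset.sum_eq_single j]
    · rw [fourierCoefficient_cubeBasis]; simp
    · intro i _ hij
      rw [fourierCoefficient_cubeBasis, if_neg hij.symm, mul_zero]
    · exact fun h => absurd hj h
  have h1 : ∫ x, h x * p x = ∑ j ∈ S, fourierCoefficient h j ^ 2 := by
    rw [hmul h hh]; simp_rw [sq]
  have h2 : ∫ x, p x * p x = ∑ j ∈ S, fourierCoefficient h j ^ 2 := by
    rw [hmul p hpc]
    exact Finset.sum_congr rfl fun j hj => by rw [hcoef j hj, sq]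
  have h3 : ∫ x, (h x - p x) ^ 2 = (∫ x, h x ^ 2) - 2 * (∫ x, h x * p x) + ∫ x, p x * p x := by
    rw [← integral_const_mul, ← integral_sub (Continuous.integrable_cube (by fun_prop))
      (Continuous.integrable_cube (by fun_prop)), ← integral_add
      (Continuous.integrable_cube (by fun_prop)) (Continuous.integrable_cube (by fun_prop))]
    congr 1 with x
    ring
  have h4 : 0 ≤ ∫ x, (h x - p x) ^ 2 := integral_nonneg fun x => sq_nonneg _
  linarith

/-! ### Band-limited perturbations and Sobolev balls -/

/-- A continuous function on the cube with values in `[-1, 1]`, with mean zero, and without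
frequency of index `N` or more in any coordinate. -/
structure IsBandLimited {d : ℕ} (N : ℕ) (h : Cube d → ℝ) : Prop where
  continuous : Continuous h
  abs_le_one : ∀ x, |h x| ≤ 1
  mean_eq_zero : fourierCoefficient h (fun _ => 1) = 0
  fourierCoefficient_eq_zero : ∀ j m, N ≤ (j m : ℕ) → fourierCoefficient h j = 0

theorem IsBandLimited.hasFiniteSupport {d N : ℕ} {h : Cube d → ℝ} (hh : IsBandLimited N h) :
    ∃ S : Finset (Fin d → ℕ+), (∀ j ∉ S, fourierCoefficient h j = 0) ∧
      ∀ j ∈ S, ∀ m, (j m : ℕ) ≤ N := by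
  have hfin : {a : ℕ+ | (a : ℕ) ≤ N}.Finite :=
    Set.Finite.preimage PNat.coe_injective.injOn (Set.finite_Iic N)
  refine ⟨Fintype.piFinset fun _ => hfin.toFinset, fun j hj => ?_, fun j hj m => ?_⟩
  · simp only [Fintype.mem_piFinset, Set.Finite.mem_toFinset, Set.mem_ofPred_eq, not_forall,
      not_le] at hj
    obtain ⟨m, hm⟩ := hj
    exact hh.fourierCoefficient_eq_zero j m hm.le
  · simpa using Fintype.mem_piFinset.mp hj m

theorem IsBandLimited.hasSum_sobolevTerm {d N : ℕ} {h : Cube d → ℝ} (hh : IsBandLimited N h)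
    (s : ℕ) : ∃ v : ℝ, v ≤ d * (N : ℝ) ^ (2 * s) ∧ HasSum (sobolevTerm s h) v := by
  obtain ⟨S, hS, hSN⟩ := hh.hasFiniteSupport
  refine ⟨∑ j ∈ S, sobolevTerm s h j, ?_, hasSum_sum_of_ne_finset_zero fun j hj => by
    simp [sobolevTerm, hS j hj]⟩
  have hb : ∫ x, h x ^ 2 ≤ 1 := by
    have : ∫ _ : Cube d, (1 : ℝ) = 1 := by simp
    rw [← this]
    refine integral_mono (hh.continuous.pow 2).integrable_cube (integrable_const _) fun x => ?_
    simpa using hh.abs_le_one x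
  calc ∑ j ∈ S, sobolevTerm s h j
      ≤ ∑ j ∈ S, (d * (N : ℝ) ^ (2 * s)) * fourierCoefficient h j ^ 2 := by
        refine Finset.sum_le_sum fun j hj => ?_
        rw [sobolevTerm]
        gcongr
        calc ∑ m, ((j m : ℕ) : ℝ) ^ (2 * s) ≤ ∑ _m : Fin d, (N : ℝ) ^ (2 * s) := by
              gcongr with m
              exact_mod_cast hSN j hj m
          _ = d * (N : ℝ) ^ (2 * s) := by simp
    _ = (d * (N : ℝ) ^ (2 * s)) * ∑ j ∈ S, fourierCoefficient h j ^ 2 := by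
        rw [Finset.mul_sum]
    _ ≤ (d * (N : ℝ) ^ (2 * s)) * 1 := by
        gcongr
        exact (sum_fourierCoefficient_sq_le hh.continuous S).trans hb
    _ = _ := mul_one _

theorem Continuous.memLp_cube {d : ℕ} {f : Cube d → ℝ} (hf : Continuous f) :
    MemLp f 2 volume :=
  hf.memLp_of_hasCompactSupport (HasCompactSupport.of_compactSpace f)

/-- Up to the factor `a ^ 2`, the Sobolev series of `b + a h` is that of `h`, apart from the
constant term `b ^ 2 d`. -/
theorem IsBandLimited.affine_mem_sobolevBall {d N : ℕ} {h : Cube d → ℝ} (hh : IsBandLimited N h)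
    {s : ℕ} {a b r : ℝ} (har : b ^ 2 * d + a ^ 2 * (d * (N : ℝ) ^ (2 * s)) ≤ r ^ 2) :
    (fun x => b + a * h x) ∈ sobolevBall d s r := by
  obtain ⟨v, hv, hsum⟩ := hh.hasSum_sobolevTerm s
  have hhc := hh.continuous
  have hs : HasSum (sobolevTerm s fun x => b + a * h x) (b ^ 2 * d + a ^ 2 * v) := by
    have h1 : HasSum (fun j : Fin d → ℕ+ => if j = (fun _ => 1) then b ^ 2 * (d : ℝ) else 0)
        (b ^ 2 * d) := hasSum_ite_eq _ _
    convert h1.add (hsum.mul_left (a ^ 2)) using 1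
    ext j
    have hc : fourierCoefficient (fun x => b + a * h x) j =
        b * fourierCoefficient (fun _ => 1) j + a * fourierCoefficient h j := by
      rw [fourierCoefficient_add_mul continuous_const hhc]
      congr 1
      rw [fourierCoefficient, fourierCoefficient, ← integral_const_mul]
      simp
    rw [sobolevTerm, sobolevTerm, hc, fourierCoefficient_one]
    by_cases hj : j = fun _ => 1
    · subst hj
      simp [hh.mean_eq_zero]
      ring
    · simp [hj]
      ring
  refine ⟨Continuous.memLp_cube (by fun_prop), hs.summable, ?_⟩
  rw [hs.tsum_eq]
  refine le_trans ?_ har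
  gcongr

theorem IsBandLimited.one_add_mem_densities {d N : ℕ} {h : Cube d → ℝ} (hh : IsBandLimited N h)
    {a : ℝ} (ha0 : 0 ≤ a) (ha1 : a ≤ 1) : (fun x => 1 + a * h x) ∈ densities d := by
  have hhc := hh.continuous
  have hc : Continuous fun x => 1 + a * h x := by fun_prop
  refine ⟨hc.measurable, fun x => ?_, hc.integrable_cube, ?_⟩
  · have := (abs_le.mp (hh.abs_le_one x)).1
    nlinarith
  · have := fourierCoefficient_add_mul continuous_const hhc a (f := fun _ => 1) fun _ => 1
    rw [hh.mean_eq_zero, fourierCoefficient_one, if_pos rfl, fourierCoefficient] at this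
    simpa [cubeBasis_one] using this

/-! ### Modulated bumps on the cube -/

/-- The frequency at which a bump is modulated in each coordinate: `2 K` in the coordinate `i₀` and
`0` in the others. As a Fejér bump has frequencies below `K`, this makes the mean vanish. -/
def carrier {d : ℕ} (i₀ : Fin d) (K : ℕ) (m : Fin d) : ℕ := (if m = i₀ then 2 else 0) * K

/-- The bump located at the node `k / K` of the grid, a tensor product of Fejér bumps modulated at
the frequencies `carrier i₀ K`. -/
noncomputable def cubeBump {d K : ℕ} (i₀ : Fin d) (k : Fin d → Fin K) (x : Cube d) : ℝ :=
  ∏ m, fejerBump K (k m) (x m) * Real.cos (2 * Real.pi * carrier i₀ K m * (x m : ℝ))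

@[fun_prop]
theorem continuous_cubeBump {d K : ℕ} (i₀ : Fin d) (k : Fin d → Fin K) :
    Continuous (cubeBump i₀ k) := by
  unfold cubeBump; fun_prop

theorem abs_cubeBump_le {d K : ℕ} (i₀ : Fin d) (k : Fin d → Fin K) (x : Cube d) :
    |cubeBump i₀ k x| ≤ ∏ m, fejerBump K (k m) (x m) := by
  rw [cubeBump, Finset.abs_prod]
  refine Finset.prod_le_prod (fun m _ => abs_nonneg _) fun m _ => ?_
  rw [abs_mul, abs_of_nonneg (fejerBump_nonneg _ _ _)]
  exact mul_le_of_le_one_right (fejerBump_nonneg _ _ _) (Real.abs_cos_le_one _)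

theorem sum_abs_cubeBump_le {d K : ℕ} (hK : 1 ≤ K) (i₀ : Fin d) (x : Cube d) :
    ∑ k : Fin d → Fin K, |cubeBump i₀ k x| ≤ 1 := by
  calc ∑ k : Fin d → Fin K, |cubeBump i₀ k x|
      ≤ ∑ k : Fin d → Fin K, ∏ m, fejerBump K (k m) (x m) :=
        Finset.sum_le_sum fun k _ => abs_cubeBump_le i₀ k x
    _ = ∏ m : Fin d, ∑ k : Fin K, fejerBump K k (x m) :=
        (Fintype.prod_sum fun (m : Fin d) (k : Fin K) => fejerBump K k (x m)).symm
    _ = 1 := Finset.prod_eq_one fun m _ => by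
        rw [Fin.sum_univ_eq_sum_range fun k => fejerBump K k (x m), sum_fejerBump hK]

theorem integral_abs_cubeBump_le {d K : ℕ} (hK : 1 ≤ K) (i₀ : Fin d) (k : Fin d → Fin K) :
    ∫ x, |cubeBump i₀ k x| ≤ (1 / (K : ℝ)) ^ d := by
  calc ∫ x, |cubeBump i₀ k x| ≤ ∫ x : Cube d, ∏ m, fejerBump K (k m) (x m) :=
        integral_mono (Continuous.integrable_cube (by fun_prop))
          (Continuous.integrable_cube (by fun_prop)) fun x => abs_cubeBump_le i₀ k x
    _ = (1 / (K : ℝ)) ^ d := by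
        rw [integral_cube_prod fun (m : Fin d) => fejerBump K (k m)]
        simp [integral_fejerBump hK]

theorem le_integral_cubeBump_sq {d K : ℕ} (i₀ : Fin d) (k : Fin d → Fin K) :
    (1 / (768 * (K : ℝ))) ^ d ≤ ∫ x, cubeBump i₀ k x ^ 2 := by
  simp_rw [cubeBump, ← Finset.prod_pow]
  rw [integral_cube_prod fun m t =>
    (fejerBump K (k m) t * Real.cos (2 * Real.pi * carrier i₀ K m * t)) ^ 2]
  calc (1 / (768 * (K : ℝ))) ^ d = ∏ _m : Fin d, 1 / (768 * (K : ℝ)) := by simp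
    _ ≤ _ := Finset.prod_le_prod (fun m _ => by positivity) fun m _ =>
        le_integral_sq_fejerBump_mul_cos (k m).2 (by split_ifs <;> norm_num)

theorem fourierCoefficient_cubeBump {d K : ℕ} (i₀ : Fin d) (k : Fin d → Fin K)
    {j : Fin d → ℕ+} {m : Fin d}
    (hm : (K : ℤ) ≤ |(((j m : ℕ) / 2 : ℕ) : ℤ) - carrier i₀ K m|) :
    fourierCoefficient (cubeBump i₀ k) j = 0 := by
  simp_rw [fourierCoefficient, cubeBump, cubeBasis, ← Finset.prod_mul_distrib]
  rw [integral_cube_prod fun m t =>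
    fejerBump K (k m) t * Real.cos (2 * Real.pi * carrier i₀ K m * t) * trigBasis (j m) t]
  refine Finset.prod_eq_zero (Finset.mem_univ m) ?_
  obtain ⟨c, b, h, -⟩ := exists_trigBasis_eq_cos (j m)
  simp_rw [h, mul_left_comm _ c]
  rw [intervalIntegral.integral_const_mul, integral_fejerBump_mul_cos_mul_cos _ hm, mul_zero]

/-- The sign encoded by a bit. -/
def bitSign (b : Bool) : ℝ := if b then 1 else -1

theorem abs_bitSign (b : Bool) : |bitSign b| = 1 := by cases b <;> simp [bitSign]

/-- The sum of all the bumps with the signs given by `ν`. -/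
noncomputable def signedBumps {d K : ℕ} (i₀ : Fin d) (ν : (Fin d → Fin K) → Bool)
    (x : Cube d) : ℝ :=
  ∑ k, bitSign (ν k) * cubeBump i₀ k x

theorem isBandLimited_signedBumps {d K : ℕ} (hK : 1 ≤ K) (i₀ : Fin d)
    (ν : (Fin d → Fin K) → Bool) : IsBandLimited (6 * K) (signedBumps i₀ ν) := by
  have hcoef : ∀ (j : Fin d → ℕ+) (m : Fin d),
      (K : ℤ) ≤ |(((j m : ℕ) / 2 : ℕ) : ℤ) - carrier i₀ K m| →
      fourierCoefficient (signedBumps i₀ ν) j = 0 := by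
    intro j m hm
    simp_rw [fourierCoefficient, signedBumps, Finset.sum_mul]
    rw [integral_finsetSum _ fun k _ => Continuous.integrable_cube (by fun_prop)]
    refine Finset.sum_eq_zero fun k _ => ?_
    simp_rw [mul_assoc]
    rw [integral_const_mul]
    have := fourierCoefficient_cubeBump i₀ k hm
    rw [fourierCoefficient] at this
    rw [this, mul_zero]
  refine ⟨by unfold signedBumps; fun_prop, fun x => ?_, hcoef _ i₀ ?_, fun j m hm => hcoef j m ?_⟩
  · refine (Finset.abs_sum_le_sum_abs _ _).trans (le_trans ?_ (sum_abs_cubeBump_le hK i₀ x))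
    simp [abs_mul, abs_bitSign]
  · simp [carrier]
    omega
  · rw [le_abs]
    left
    rw [carrier]
    split_ifs <;> push_cast <;> omega

/-! ### Contraction of private channels -/

theorem integrable_of_abs_le {Ω : Type*} [MeasurableSpace Ω] {μ : Measure Ω} [IsFiniteMeasure μ]
    {g : Ω → ℝ} (hg : Measurable g) {M : ℝ} (hM : ∀ ω, |g ω| ≤ M) : Integrable g μ :=
  Integrable.of_bound hg.aestronglyMeasurable M (ae_of_all _ hM)

theorem abs_integral_le_of_abs_le {Ω : Type*} [MeasurableSpace Ω] {μ : Measure Ω}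
    [IsProbabilityMeasure μ] {g : Ω → ℝ} {M : ℝ} (hM : ∀ ω, |g ω| ≤ M) :
    |∫ ω, g ω ∂μ| ≤ M := by
  simpa using norm_integral_le_of_norm_le_const (μ := μ) (f := g) (ae_of_all _ hM)

theorem integral_sub_const_sq {Ω : Type*} [MeasurableSpace Ω] {μ : Measure Ω}
    [IsProbabilityMeasure μ] {v : Ω → ℝ} (hv : Measurable v) {M : ℝ} (hM : ∀ ω, |v ω| ≤ M) (c : ℝ) :
    ∫ ω, (v ω - c) ^ 2 ∂μ = ∫ ω, v ω ^ 2 ∂μ - 2 * c * ∫ ω, v ω ∂μ + c ^ 2 := by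
  have i1 : Integrable v μ := integrable_of_abs_le hv hM
  have i2 : Integrable (fun ω => v ω ^ 2) μ :=
    integrable_of_abs_le (M := M ^ 2) (by fun_prop) fun ω => by
      rw [abs_pow]; exact pow_le_pow_left₀ (abs_nonneg _) (hM ω) 2
  have h : ∀ ω, (v ω - c) ^ 2 = v ω ^ 2 + (c ^ 2 - 2 * c * v ω) := fun ω => by ring
  simp_rw [h]
  have i3 : Integrable (fun ω => c ^ 2 - 2 * c * v ω) μ :=
    (integrable_const _).sub (i1.const_mul _)
  rw [integral_add i2 i3, integral_sub (integrable_const _) (i1.const_mul _), integral_const_mul]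
  simp
  ring

theorem sq_integral_abs_le {Ω : Type*} [MeasurableSpace Ω] {μ : Measure Ω} [IsProbabilityMeasure μ]
    {u : Ω → ℝ} (hu : Measurable u) {M : ℝ} (hM : ∀ ω, |u ω| ≤ M) :
    (∫ ω, |u ω| ∂μ) ^ 2 ≤ ∫ ω, u ω ^ 2 ∂μ := by
  have h := integral_sub_const_sq (μ := μ) (v := fun ω => |u ω|) (by fun_prop) (M := M)
    (fun ω => by rw [abs_abs]; exact hM ω) (∫ ω, |u ω| ∂μ)
  have h0 : 0 ≤ ∫ ω, (|u ω| - ∫ ω, |u ω| ∂μ) ^ 2 ∂μ := integral_nonneg fun ω => sq_nonneg _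
  simp_rw [sq_abs] at h
  nlinarith

/-- If two distributions of the datum differ by at most `τ` in total variation norm, then the
second moments under the laws of its private view compare with a factor
`1 + ((e^α - e^(-α)) τ)²`. Privacy enters through the fact that integrating a function centred for
one of these laws against the channel gives at most `e^α - e^(-α)` times its first absolute
moment, uniformly in the datum. -/
theorem sq_integral_channel_le {X Z : Type*} [MeasurableSpace X] [MeasurableSpace Z]
    (Q : Kernel X Z) [IsMarkovKernel Q] {α τ : ℝ}
    (hQ : ∀ (x x' : X) (B : Set Z), MeasurableSet B →
      Q x B ≤ ENNReal.ofReal (Real.exp α) * Q x' B)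
    (P P' : Measure X) [IsProbabilityMeasure P] [IsProbabilityMeasure P']
    (hP : ∀ q : X → ℝ, Measurable q → ∀ M : ℝ, (∀ x, |q x| ≤ M) →
      |∫ x, q x ∂P' - ∫ x, q x ∂P| ≤ M * τ)
    {g : Z → ℝ} (hg : Measurable g) (hg1 : ∀ z, |g z| ≤ 1) :
    (∫ x, ∫ z, g z ∂(Q x) ∂P') ^ 2 ≤
      (1 + ((Real.exp α - Real.exp (-α)) * τ) ^ 2) * ∫ x, ∫ z, g z ^ 2 ∂(Q x) ∂P := by
  set κ : Measure Z := P.bind Q with hκ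
  have : IsProbabilityMeasure κ := by rw [hκ]; infer_instance
  have hκB : ∀ B, MeasurableSet B → κ B = ∫⁻ x, Q x B ∂P := fun B hB =>
    Measure.bind_apply hB Q.aemeasurable
  have hQκ : ∀ x, Q x ≤ ENNReal.ofReal (Real.exp α) • κ := by
    intro x
    refine Measure.le_iff.mpr fun B hB => ?_
    rw [Measure.smul_apply, hκB B hB, smul_eq_mul,
      ← lintegral_const_mul _ (Q.measurable_coe hB)]
    calc Q x B = ∫⁻ _, Q x B ∂P := by simp
      _ ≤ _ := lintegral_mono fun x' => hQ x x' B hB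
  have hκQ : ∀ x, κ ≤ ENNReal.ofReal (Real.exp α) • Q x := by
    intro x
    refine Measure.le_iff.mpr fun B hB => ?_
    rw [Measure.smul_apply, hκB B hB, smul_eq_mul]
    calc ∫⁻ x', Q x' B ∂P ≤ ∫⁻ _, ENNReal.ofReal (Real.exp α) * Q x B ∂P :=
          lintegral_mono fun x' => hQ x' x B hB
      _ = _ := by simp
  have hint : ∀ v : Z → ℝ, Measurable v → (∃ M, ∀ z, |v z| ≤ M) →
      ∫ x, ∫ z, v z ∂(Q x) ∂P = ∫ z, v z ∂κ := by
    rintro v hv ⟨M, hM⟩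
    have h := Kernel.integral_comp (κ := Kernel.const Unit P) (η := Q) (a := ()) (f := v)
      (integrable_of_abs_le hv hM)
    rw [Kernel.comp_apply, Kernel.const_apply] at h
    exact h.symm
  have hexp : 0 < Real.exp α := Real.exp_pos α
  have hmono : ∀ {μ ν : Measure Z} [IsProbabilityMeasure μ] [IsProbabilityMeasure ν],
      μ ≤ ENNReal.ofReal (Real.exp α) • ν → ∀ v : Z → ℝ, Measurable v → (∀ z, 0 ≤ v z) →
      (∃ M, ∀ z, |v z| ≤ M) → ∫ z, v z ∂μ ≤ Real.exp α * ∫ z, v z ∂ν := by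
    intro μ ν _ _ hμν v hv hv0 ⟨M, hM⟩
    have h1 := integral_mono_measure hμν (ae_of_all _ hv0)
      ((integrable_of_abs_le (μ := ν) hv hM).smul_measure ENNReal.ofReal_ne_top)
    rwa [integral_smul_measure, ENNReal.toReal_ofReal hexp.le] at h1
  set m := ∫ z, g z ∂κ with hm
  have hm1 : |m| ≤ 1 := abs_integral_le_of_abs_le hg1
  set u : Z → ℝ := fun z => g z - m with hu
  have hum : Measurable u := by fun_prop
  have hu2 : ∀ z, |u z| ≤ 2 := fun z => (abs_sub _ _).trans (by linarith [hg1 z])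
  have hu0 : ∫ z, u z ∂κ = 0 := by
    rw [hu, integral_sub (integrable_of_abs_le hg hg1) (integrable_const _)]
    simp [hm]
  set D := ∫ z, |u z| ∂κ with hD
  set q : X → ℝ := fun x => ∫ z, u z ∂(Q x) with hq
  have hqm : Measurable q := (hum.stronglyMeasurable.integral_kernel (κ := Q)).measurable
  have hqD : ∀ x, |q x| ≤ (Real.exp α - Real.exp (-α)) * D := by
    intro x
    have hiu : ∀ (μ : Measure Z) [IsProbabilityMeasure μ], Integrable u μ := fun μ _ =>
      integrable_of_abs_le hum hu2
    have hlow : Real.exp (-α) * D ≤ ∫ z, |u z| ∂(Q x) := by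
      have := hmono (hκQ x) (fun z => |u z|) (by fun_prop) (fun z => abs_nonneg _)
        ⟨2, fun z => by rw [abs_abs]; exact hu2 z⟩
      rw [Real.exp_neg, inv_mul_le_iff₀ hexp]
      exact this
    -- Compare the integrals of the nonnegative functions `|u| ± u`, as `u` has mean zero under `κ`.
    rw [abs_le']
    constructor
    · have := hmono (hQκ x) (fun z => |u z| + u z) (by fun_prop)
        (fun z => by linarith [neg_abs_le (u z)])
        ⟨4, fun z => (abs_add_le _ _).trans (by rw [abs_abs]; linarith [hu2 z])⟩
      rw [integral_add (hiu _).abs (hiu _), integral_add (hiu _).abs (hiu _), hu0] at this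
      linarith
    · have := hmono (hQκ x) (fun z => |u z| - u z) (by fun_prop)
        (fun z => by linarith [le_abs_self (u z)])
        ⟨4, fun z => (abs_sub _ _).trans (by rw [abs_abs]; linarith [hu2 z])⟩
      rw [integral_sub (hiu _).abs (hiu _), integral_sub (hiu _).abs (hiu _), hu0] at this
      linarith
  have hqP : ∫ x, q x ∂P = 0 := by rw [hint u hum ⟨2, hu2⟩, hu0]
  have ht := hP q hqm _ hqD
  rw [hqP, sub_zero] at ht
  set t := ∫ x, q x ∂P' with htdef
  have hmt : ∫ x, ∫ z, g z ∂(Q x) ∂P' = m + t := by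
    have : ∀ x, ∫ z, g z ∂(Q x) = m + q x := by
      intro x
      rw [hq]
      simp only [hu]
      rw [integral_sub (integrable_of_abs_le hg hg1) (integrable_const _)]
      simp
    simp_rw [this]
    rw [integral_add (integrable_const _) (integrable_of_abs_le hqm hqD)]
    simp [htdef]
  have hg2 : ∀ z, |g z ^ 2| ≤ 1 := fun z => by
    rw [abs_pow]; exact pow_le_one₀ (abs_nonneg _) (hg1 z)
  have hvar : ∫ z, u z ^ 2 ∂κ = ∫ z, g z ^ 2 ∂κ - m ^ 2 := by
    rw [hu, integral_sub_const_sq hg hg1, ← hm]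
    ring
  have hD2 : D ^ 2 ≤ ∫ z, u z ^ 2 ∂κ := sq_integral_abs_le hum hu2
  rw [hint _ (by fun_prop) ⟨1, hg2⟩, hmt]
  have hs : |t| ≤ ((Real.exp α - Real.exp (-α)) * τ) * D := by linarith
  set s := (Real.exp α - Real.exp (-α)) * τ
  have ht2 : t ^ 2 ≤ (s * D) ^ 2 := by
    rw [← sq_abs t]; exact pow_le_pow_left₀ (abs_nonneg _) hs 2
  have hmt2 : 2 * (m * t) ≤ s ^ 2 * m ^ 2 + D ^ 2 := by
    have h1 : m * t ≤ |m| * (s * D) := by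
      calc m * t ≤ |m * t| := le_abs_self _
        _ = |m| * |t| := abs_mul _ _
        _ ≤ _ := by gcongr
    nlinarith [sq_nonneg (s * |m| - D), sq_abs m]
  have hfin : (m + t) ^ 2 ≤ (1 + s ^ 2) * (m ^ 2 + D ^ 2) := by nlinarith
  exact hfin.trans (mul_le_mul_of_nonneg_left (by linarith) (by positivity))

/-! ### The law of the views of the first individuals -/

section Views

variable {n : ℕ} {X : Type*} [MeasurableSpace X] {Z : Type u} [MeasurableSpace Z]

theorem measurable_snoc {k : ℕ} {Y : Type*} [MeasurableSpace Y] :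
    Measurable fun p : (Fin k → Y) × Y => (Fin.snoc p.1 p.2 : Fin (k + 1) → Y) := by
  refine measurable_pi_iff.mpr fun i => ?_
  refine Fin.lastCases ?_ (fun i => ?_) i
  · simpa using measurable_snd
  · simp only [Fin.snoc_castSucc]
    fun_prop

instance isMarkovKernel_channel (Q : Mechanism n X Z) {k : ℕ} (hk : k < n) :
    IsMarkovKernel (Q.channel ⟨k, hk⟩ : Kernel (X × (Fin k → Z)) Z) := Q.isMarkov ⟨k, hk⟩

instance isMarkovKernel_stepKernel {k : ℕ} (P : Measure X) [IsProbabilityMeasure P]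
    (K : Kernel (X × (Fin k → Z)) Z) [IsMarkovKernel K] : IsMarkovKernel (stepKernel P K) := by
  unfold stepKernel; infer_instance

instance isProbabilityMeasure_jointLaw (Q : Mechanism n X Z) (P : Measure X)
    [IsProbabilityMeasure P] (k : ℕ) (hk : k ≤ n) : IsProbabilityMeasure (Q.jointLaw P k hk) := by
  induction k with
  | zero => unfold Mechanism.jointLaw; infer_instance
  | succ k ih =>
    have := ih (Nat.le_of_succ_le hk)
    unfold Mechanism.jointLaw
    exact Measure.isProbabilityMeasure_map measurable_snoc.aemeasurable

theorem measurable_views (k : ℕ) : Measurable fun (h : Fin k → X × Z) i => (h i).2 := by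
  fun_prop

/-- The law of the views of the first `k` individuals. -/
noncomputable def Mechanism.firstViewsLaw (Q : Mechanism n X Z) (P : Measure X) (k : ℕ)
    (hk : k ≤ n) : Measure (Fin k → Z) :=
  (Q.jointLaw P k hk).map (fun h i => (h i).2)

instance isProbabilityMeasure_firstViewsLaw (Q : Mechanism n X Z) (P : Measure X)
    [IsProbabilityMeasure P] (k : ℕ) (hk : k ≤ n) :
    IsProbabilityMeasure (Q.firstViewsLaw P k hk) :=
  Measure.isProbabilityMeasure_map (measurable_views k).aemeasurable

theorem Mechanism.measurable_integral_channel (Q : Mechanism n X Z) (P : Measure X)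
    [IsProbabilityMeasure P] {k : ℕ} (hk : k < n) {g : (Fin (k + 1) → Z) → ℝ} (hg : Measurable g) :
    Measurable fun z => ∫ x, ∫ z', g (Fin.snoc z z') ∂(Q.channel ⟨k, hk⟩ (x, z)) ∂P := by
  have h1 : StronglyMeasurable fun p : (X × (Fin k → Z)) × Z => g (Fin.snoc p.1.2 p.2) :=
    (hg.comp (measurable_snoc.comp (by fun_prop :
      Measurable fun p : (X × (Fin k → Z)) × Z => (p.1.2, p.2)))).stronglyMeasurable
  have h2 := h1.integral_kernel_prod_right' (κ := Q.channel ⟨k, hk⟩)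
  exact (h2.integral_prod_left' (μ := P)).measurable

theorem Mechanism.integral_firstViewsLaw_succ (Q : Mechanism n X Z) (P : Measure X)
    [IsProbabilityMeasure P] {k : ℕ} (hk : k + 1 ≤ n) {g : (Fin (k + 1) → Z) → ℝ}
    (hg : Measurable g) {M : ℝ} (hM : ∀ z, |g z| ≤ M) :
    ∫ z, g z ∂(Q.firstViewsLaw P (k + 1) hk) =
      ∫ z, ∫ x, ∫ z', g (Fin.snoc z z') ∂(Q.channel ⟨k, hk⟩ (x, z)) ∂P
        ∂(Q.firstViewsLaw P k (Nat.le_of_succ_le hk)) := by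
  have hviews := measurable_views (X := X) (Z := Z) (k + 1)
  rw [firstViewsLaw, firstViewsLaw, integral_map hviews.aemeasurable hg.aestronglyMeasurable,
    integral_map (measurable_views k).aemeasurable
      (Q.measurable_integral_channel P hk hg).aestronglyMeasurable,
    jointLaw, integral_map measurable_snoc.aemeasurable
      (f := fun h : Fin (k + 1) → X × Z => g fun i => (h i).2)
      (hg.comp hviews).aestronglyMeasurable]
  have hm : Measurable fun p : (Fin k → X × Z) × (X × Z) =>
      g fun i => ((Fin.snoc p.1 p.2 : Fin (k + 1) → X × Z) i).2 :=
    hg.comp (hviews.comp measurable_snoc)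
  rw [Measure.integral_compProd (integrable_of_abs_le hm fun _ => hM _)]
  congr 1 with h
  have hmh : Measurable fun b : X × Z =>
      g fun i => ((Fin.snoc (h, b).1 (h, b).2 : Fin (k + 1) → X × Z) i).2 :=
    hm.comp measurable_prodMk_left
  rw [stepKernel, integral_compProd (integrable_of_abs_le hmh fun _ => hM _)]
  simp only [Kernel.const_apply, Kernel.comap_apply]
  congr 1 with x
  congr 1 with z'
  congr 1 with i
  refine Fin.lastCases ?_ (fun i => ?_) i <;> simp

/-- Second moments under the laws of the views, when the law of the data changes: the induction step
applies the bound for a single channel to the next view, the previous ones being fixed. -/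
theorem Mechanism.sq_integral_firstViewsLaw_le (Q : Mechanism n X Z) {α τ : ℝ} (hQ : Q.IsLDP α)
    (P P' : Measure X) [IsProbabilityMeasure P] [IsProbabilityMeasure P']
    (hP : ∀ q : X → ℝ, Measurable q → ∀ M : ℝ, (∀ x, |q x| ≤ M) →
      |∫ x, q x ∂P' - ∫ x, q x ∂P| ≤ M * τ)
    (k : ℕ) (hk : k ≤ n) (g : (Fin k → Z) → ℝ) (hg : Measurable g) (hg1 : ∀ z, |g z| ≤ 1) :
    (∫ z, g z ∂(Q.firstViewsLaw P' k hk)) ^ 2 ≤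
      (1 + ((Real.exp α - Real.exp (-α)) * τ) ^ 2) ^ k *
        ∫ z, g z ^ 2 ∂(Q.firstViewsLaw P k hk) := by
  induction k with
  | zero =>
    have hc : ∀ z : Fin 0 → Z, g z = g Fin.elim0 := fun z => congrArg g (Subsingleton.elim _ _)
    simp_rw [hc]
    simp
  | succ k ih =>
    set C := 1 + ((Real.exp α - Real.exp (-α)) * τ) ^ 2
    have hg2 : ∀ z, |g z ^ 2| ≤ 1 := fun z => by
      rw [abs_pow]; exact pow_le_one₀ (abs_nonneg _) (hg1 z)
    have hb : ∀ (P : Measure X) [IsProbabilityMeasure P] (h : (Fin (k + 1) → Z) → ℝ)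
        (_ : ∀ z, |h z| ≤ 1) (z : Fin k → Z),
        |∫ x, ∫ z', h (Fin.snoc z z') ∂(Q.channel ⟨k, hk⟩ (x, z)) ∂P| ≤ 1 := by
      intro P _ h hh z
      exact abs_integral_le_of_abs_le fun x => abs_integral_le_of_abs_le fun z' => hh _
    rw [Q.integral_firstViewsLaw_succ P' hk hg hg1,
      Q.integral_firstViewsLaw_succ P hk (hg.pow_const 2) hg2]
    refine (ih (Nat.le_of_succ_le hk) _ (Q.measurable_integral_channel P' hk hg)
      (hb P' g hg1)).trans ?_
    have hC : 0 ≤ C := by positivity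
    rw [pow_succ, mul_assoc]
    refine mul_le_mul_of_nonneg_left ?_ (pow_nonneg hC k)
    rw [← integral_const_mul]
    refine integral_mono ?_ ?_ fun z => ?_
    · refine integrable_of_abs_le (M := 1)
        ((Q.measurable_integral_channel P' hk hg).pow_const 2) fun z => ?_
      rw [abs_pow]; exact pow_le_one₀ (abs_nonneg _) (hb P' g hg1 z)
    · exact (integrable_of_abs_le (Q.measurable_integral_channel P hk (hg.pow_const 2))
        (hb P _ hg2)).const_mul C
    · have hmz : Measurable fun x : X => (x, z) := by fun_prop
      have := sq_integral_channel_le ((Q.channel ⟨k, hk⟩).comap _ hmz) (α := α) (τ := τ)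
        (fun x x' B hB => hQ ⟨k, hk⟩ z x x' B hB) P P' hP
        (g := fun z' => g (Fin.snoc z z'))
        (hg.comp (measurable_snoc.comp measurable_prodMk_left)) fun z' => hg1 _
      simpa only [Kernel.comap_apply] using this

instance isProbabilityMeasure_viewLaw (Q : Mechanism n X Z) (P : Measure X)
    [IsProbabilityMeasure P] : IsProbabilityMeasure (Q.viewLaw P) :=
  isProbabilityMeasure_firstViewsLaw Q P n le_rfl

/-- If the laws of the data are so close that `n s² ≤ 1 / 2`, an event that is unlikely for one law of
the views is unlikely for the other. -/
theorem Mechanism.sq_viewLaw_le (Q : Mechanism n X Z) {α τ : ℝ} (hQ : Q.IsLDP α)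
    (P P' : Measure X) [IsProbabilityMeasure P] [IsProbabilityMeasure P']
    (hP : ∀ q : X → ℝ, Measurable q → ∀ M : ℝ, (∀ x, |q x| ≤ M) →
      |∫ x, q x ∂P' - ∫ x, q x ∂P| ≤ M * τ)
    (hn : (n : ℝ) * ((Real.exp α - Real.exp (-α)) * τ) ^ 2 ≤ 1 / 2)
    {B : Set (Fin n → Z)} (hB : MeasurableSet B) :
    (Q.viewLaw P').real B ^ 2 ≤ 2 * (Q.viewLaw P).real B := by
  have h := Q.sq_integral_firstViewsLaw_le hQ P P' hP n le_rfl (B.indicator (1 : (Fin n → Z) → ℝ))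
    ((measurable_const (a := (1 : ℝ))).indicator hB) fun z => by
      by_cases hz : z ∈ B <;> simp [hz]
  have h2 : ∀ z, B.indicator (1 : (Fin n → Z) → ℝ) z ^ 2 =
      B.indicator (1 : (Fin n → Z) → ℝ) z := fun z => by
    by_cases hz : z ∈ B <;> simp [hz]
  simp_rw [h2] at h
  rw [integral_indicator_one hB, integral_indicator_one hB] at h
  refine h.trans (mul_le_mul_of_nonneg_right ?_ measureReal_nonneg)
  set s := (Real.exp α - Real.exp (-α)) * τ
  calc (1 + s ^ 2) ^ n ≤ Real.exp (s ^ 2) ^ n := by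
        gcongr; rw [add_comm]; exact Real.add_one_le_exp _
    _ = Real.exp (n * s ^ 2) := by rw [← Real.exp_nat_mul]
    _ ≤ Real.exp (1 / 2) := Real.exp_le_exp.mpr hn
    _ ≤ 2 := by
        have h3 : Real.exp (1 / 2) ^ 2 = Real.exp 1 := by rw [← Real.exp_nat_mul]; norm_num
        nlinarith [Real.exp_one_lt_d9, Real.exp_pos (1 / 2)]

end Views

/-! ### Two-point comparison and Assouad's lemma -/

/-- Two nonnegative functions whose sum is at least `D` cannot both have small means under two laws
that are not well separated: split according to whether the first one reaches `D / 2`. -/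
theorem le_lintegral_add_lintegral {Ω : Type*} [MeasurableSpace Ω] {μ μ' : Measure Ω}
    [IsProbabilityMeasure μ] [IsProbabilityMeasure μ']
    (h : ∀ B, MeasurableSet B → μ'.real B ^ 2 ≤ 2 * μ.real B) {a a' : Ω → ℝ≥0∞}
    (ha : Measurable a) (ha' : Measurable a') {D : ℝ} (hD : 0 ≤ D)
    (hsep : ∀ ω, ENNReal.ofReal D ≤ a ω + a' ω) :
    ENNReal.ofReal (D / 4) ≤ ∫⁻ ω, a ω ∂μ + ∫⁻ ω, a' ω ∂μ' := by
  set B : Set Ω := {ω | ENNReal.ofReal (D / 2) ≤ a ω} with hBdef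
  have hB : MeasurableSet B := measurableSet_le measurable_const ha
  have h1 := mul_meas_ge_le_lintegral (μ := μ) ha (ENNReal.ofReal (D / 2))
  have h2 := mul_meas_ge_le_lintegral (μ := μ') ha' (ENNReal.ofReal (D / 2))
  have hsub : Bᶜ ⊆ {ω | ENNReal.ofReal (D / 2) ≤ a' ω} := by
    intro ω hω
    simp only [hBdef, Set.mem_compl_iff, Set.mem_ofPred_eq, not_le] at hω ⊢
    by_contra! hlt
    have := hsep ω
    rw [← add_halves D, ENNReal.ofReal_add (by linarith) (by linarith)] at this
    exact absurd this (not_le.mpr (ENNReal.add_lt_add hω hlt))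
  have hreal : D / 4 ≤ D / 2 * μ.real B + D / 2 * μ'.real Bᶜ := by
    rw [probReal_compl_eq_one_sub hB]
    nlinarith [h B hB, sq_nonneg (1 - μ'.real B)]
  calc ENNReal.ofReal (D / 4) ≤ ENNReal.ofReal (D / 2 * μ.real B + D / 2 * μ'.real Bᶜ) :=
        ENNReal.ofReal_le_ofReal hreal
    _ = ENNReal.ofReal (D / 2) * μ B + ENNReal.ofReal (D / 2) * μ' Bᶜ := by
        rw [ENNReal.ofReal_add (by positivity) (by positivity), ENNReal.ofReal_mul (by positivity),
          ENNReal.ofReal_mul (by positivity), ofReal_measureReal, ofReal_measureReal]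
    _ ≤ _ := add_le_add h1 (le_trans (by gcongr) h2)

/-- The sign pattern `ν` with the bit of index `k` flipped. -/
def flipBit {ι : Type*} [DecidableEq ι] (k : ι) (ν : ι → Bool) : ι → Bool :=
  Function.update ν k (!ν k)

theorem flipBit_involutive {ι : Type*} [DecidableEq ι] (k : ι) :
    Function.Involutive (flipBit k) := fun ν => by
  simp [flipBit]

/-- Assouad's lemma: if for each bit the losses under two laws whose patterns differ in this bit
only add up to at least `D` while these laws are not well separated, then some pattern has a
cumulated loss of at least `D / 8` per bit. -/
theorem card_mul_le_of_flipBit {ι Ω : Type*} [Fintype ι] [DecidableEq ι] [MeasurableSpace Ω]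
    (μ : (ι → Bool) → Measure Ω) [∀ ν, IsProbabilityMeasure (μ ν)]
    (a : ι → (ι → Bool) → Ω → ℝ≥0∞) (ha : ∀ k ν, Measurable (a k ν)) {D : ℝ} (hD : 0 ≤ D)
    (hsep : ∀ k ν ω, ENNReal.ofReal D ≤ a k ν ω + a k (flipBit k ν) ω)
    (hμ : ∀ k ν B, MeasurableSet B → (μ (flipBit k ν)).real B ^ 2 ≤ 2 * (μ ν).real B)
    {ρ : ℝ≥0∞} (hρ : ∀ ν, ∫⁻ ω, ∑ k, a k ν ω ∂(μ ν) ≤ ρ) :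
    ENNReal.ofReal (Fintype.card ι * (D / 8)) ≤ ρ := by
  set N := Fintype.card (ι → Bool)
  have hN : N ≠ 0 := Fintype.card_ne_zero
  have hbit : ∀ k, ENNReal.ofReal (N * (D / 4)) ≤ 2 * ∑ ν, ∫⁻ ω, a k ν ω ∂(μ ν) := by
    intro k
    have hflip : ∑ ν, ∫⁻ ω, a k ν ω ∂(μ ν) =
        ∑ ν, ∫⁻ ω, a k (flipBit k ν) ω ∂(μ (flipBit k ν)) :=
      (Equiv.sum_comp (flipBit_involutive k).toPerm fun ν => ∫⁻ ω, a k ν ω ∂(μ ν)).symm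
    calc ENNReal.ofReal (N * (D / 4)) = ∑ _ν : ι → Bool, ENNReal.ofReal (D / 4) := by
          rw [ENNReal.ofReal_mul (by positivity)]; simp [N]
      _ ≤ ∑ ν, (∫⁻ ω, a k ν ω ∂(μ ν) + ∫⁻ ω, a k (flipBit k ν) ω ∂(μ (flipBit k ν))) :=
          Finset.sum_le_sum fun ν _ =>
            le_lintegral_add_lintegral (hμ k ν) (ha _ _) (ha _ _) hD (hsep k ν)
      _ = _ := by rw [Finset.sum_add_distrib, ← hflip, two_mul]
  have htotal : ENNReal.ofReal (Fintype.card ι * (N * (D / 4))) ≤ 2 * (N * ρ) := by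
    calc ENNReal.ofReal (Fintype.card ι * (N * (D / 4)))
        = ∑ _k : ι, ENNReal.ofReal (N * (D / 4)) := by
          rw [ENNReal.ofReal_mul (by positivity)]; simp
      _ ≤ ∑ k, 2 * ∑ ν, ∫⁻ ω, a k ν ω ∂(μ ν) := Finset.sum_le_sum fun k _ => hbit k
      _ = 2 * ∑ ν, ∫⁻ ω, ∑ k, a k ν ω ∂(μ ν) := by
          rw [← Finset.mul_sum, Finset.sum_comm]
          congr 1
          refine Finset.sum_congr rfl fun ν _ => ?_
          rw [lintegral_finsetSum _ fun k _ => ha k ν]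
      _ ≤ 2 * ∑ _ν : ι → Bool, ρ := by gcongr with ν; exact hρ ν
      _ = 2 * (N * ρ) := by simp [N]
  rw [show (Fintype.card ι : ℝ) * (N * (D / 4)) = (2 * N : ℕ) * (Fintype.card ι * (D / 8)) by
    push_cast; ring, ENNReal.ofReal_mul (by positivity), ENNReal.ofReal_natCast, ← mul_assoc,
    show (2 : ℝ≥0∞) * N = (2 * N : ℕ) by push_cast; rfl] at htotal
  exact (ENNReal.mul_le_mul_iff_right (by simpa using hN) (ENNReal.natCast_ne_top _)).mp htotal

/-! ### The hypotheses indexed by sign patterns -/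

theorem isProbabilityMeasure_densityLaw {d : ℕ} {f : Cube d → ℝ} (hf : f ∈ densities d) :
    IsProbabilityMeasure (densityLaw f) := by
  obtain ⟨hm, h0, hi, h1⟩ := hf
  refine ⟨?_⟩
  rw [densityLaw, withDensity_apply _ MeasurableSet.univ, Measure.restrict_univ,
    ← ofReal_integral_eq_lintegral_ofReal hi (ae_of_all _ h0), h1, ENNReal.ofReal_one]

theorem abs_integral_densityLaw_sub_le {d : ℕ} {f f' : Cube d → ℝ} (hf : f ∈ densities d)
    (hf' : f' ∈ densities d) {q : Cube d → ℝ} (hq : Measurable q) {M : ℝ}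
    (hM : ∀ x, |q x| ≤ M) :
    |∫ x, q x ∂(densityLaw f') - ∫ x, q x ∂(densityLaw f)| ≤ M * ∫ x, |f' x - f x| := by
  have hint : ∀ f ∈ densities d, ∫ x, q x ∂(densityLaw f) = ∫ x, f x * q x := by
    rintro f ⟨hm, h0, hi, h1⟩
    rw [densityLaw, integral_withDensity_eq_integral_toReal_smul (by fun_prop)
      (ae_of_all _ fun x => ENNReal.ofReal_lt_top)]
    congr 1 with x
    rw [ENNReal.toReal_ofReal (h0 x), smul_eq_mul]
  have hi : ∀ f ∈ densities d, Integrable fun x => f x * q x := fun f hf =>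
    hf.2.2.1.mul_bdd hq.aestronglyMeasurable (ae_of_all _ hM)
  rw [hint f hf, hint f' hf', ← integral_sub (hi f' hf') (hi f hf), ← integral_const_mul]
  refine abs_integral_le_integral_abs.trans (integral_mono ((hi f' hf').sub (hi f hf)).abs
    ((hf'.2.2.1.sub hf.2.2.1).abs.const_mul M) fun x => ?_)
  simp only [← sub_mul, abs_mul]
  rw [mul_comm]
  gcongr
  exact hM x

theorem signedBumps_flipBit {d K : ℕ} (i₀ : Fin d) (k : Fin d → Fin K)
    (ν : (Fin d → Fin K) → Bool) (x : Cube d) :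
    signedBumps i₀ (flipBit k ν) x =
      signedBumps i₀ ν x - 2 * bitSign (ν k) * cubeBump i₀ k x := by
  rw [signedBumps, signedBumps, ← Finset.add_sum_erase _ _ (Finset.mem_univ k),
    ← Finset.add_sum_erase Finset.univ (fun k => bitSign (ν k) * cubeBump i₀ k x)
      (Finset.mem_univ k)]
  have h1 : ∀ l ∈ Finset.univ.erase k, bitSign (flipBit k ν l) * cubeBump i₀ l x =
      bitSign (ν l) * cubeBump i₀ l x := fun l hl => by
    rw [flipBit, Function.update_of_ne (Finset.ne_of_mem_erase hl)]
  have h2 : bitSign (flipBit k ν k) = -bitSign (ν k) := by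
    rw [flipBit, Function.update_self]
    cases ν k <;> simp [bitSign]
  rw [Finset.sum_congr rfl h1, h2]
  ring

theorem integrable_sub_mul_cubeBump {d K : ℕ} (hK : 1 ≤ K) (i₀ : Fin d) {f₁ f₂ : Cube d → ℝ}
    (hf₁ : Integrable f₁ volume) (hf₂ : Integrable f₂ volume) (k : Fin d → Fin K) :
    Integrable fun x => (f₁ x - f₂ x) * cubeBump i₀ k x := by
  have hb : ∀ x, ‖cubeBump i₀ k x‖ ≤ 1 := fun x =>
    (Finset.single_le_sum (f := fun k => |cubeBump i₀ k x|) (fun _ _ => abs_nonneg _)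
      (Finset.mem_univ k)).trans (sum_abs_cubeBump_le hK i₀ x)
  exact (hf₁.sub hf₂).mul_bdd (continuous_cubeBump i₀ k).aestronglyMeasurable (ae_of_all _ hb)

/-- Testing against the signed bumps whose signs are those of the scalar products with the
individual bumps bounds the adversarial loss from below by the sum of their absolute values. -/
theorem sum_abs_integral_mul_cubeBump_le_adversarialLoss {d K δ : ℕ} (hK : 1 ≤ K) (i₀ : Fin d)
    {f₁ f₂ : Cube d → ℝ} (hf₁ : Integrable f₁ volume) (hf₂ : Integrable f₂ volume) :
    ∑ k : Fin d → Fin K, ENNReal.ofReal (1 / (d * (6 * K : ℕ) ^ δ) *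
        |∫ x, (f₁ x - f₂ x) * cubeBump i₀ k x|) ≤
      adversarialLoss (sobolevBall d δ 1) f₁ f₂ := by
  set a : ℝ := 1 / (d * ((6 * K : ℕ) : ℝ) ^ δ) with ha
  have hd : (1 : ℝ) ≤ d := by exact_mod_cast (Nat.one_le_of_lt i₀.2)
  have hK6 : (0 : ℝ) < (6 * K : ℕ) := by exact_mod_cast (by omega : 0 < 6 * K)
  have ha0 : 0 ≤ a := by positivity
  set I : (Fin d → Fin K) → ℝ := fun k => ∫ x, (f₁ x - f₂ x) * cubeBump i₀ k x with hI
  set ν : (Fin d → Fin K) → Bool := fun k => decide (0 ≤ I k)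
  have hν : ∀ k, bitSign (ν k) * I k = |I k| := by
    intro k
    by_cases h : 0 ≤ I k
    · simp [ν, bitSign, h, abs_of_nonneg h]
    · simp [ν, bitSign, h, abs_of_neg (not_le.mp h)]
  have hmem : (fun x => 0 + a * signedBumps i₀ ν x) ∈ sobolevBall d δ 1 := by
    refine (isBandLimited_signedBumps hK i₀ ν).affine_mem_sobolevBall ?_
    have : a ^ 2 * (d * ((6 * K : ℕ) : ℝ) ^ (2 * δ)) = 1 / d := by
      rw [ha]; field_simp; ring
    rw [this, sq, zero_mul, zero_mul, zero_add, one_pow, div_le_one (by linarith)]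
    exact hd
  have hint := integrable_sub_mul_cubeBump hK i₀ hf₁ hf₂
  have hval : ∫ x, (f₁ x - f₂ x) * (0 + a * signedBumps i₀ ν x) = ∑ k, a * |I k| := by
    have : ∀ x, (f₁ x - f₂ x) * (0 + a * signedBumps i₀ ν x) =
        ∑ k, (a * bitSign (ν k)) * ((f₁ x - f₂ x) * cubeBump i₀ k x) := fun x => by
      rw [signedBumps, zero_add, Finset.mul_sum, Finset.mul_sum]
      exact Finset.sum_congr rfl fun k _ => by ring
    simp_rw [this]
    rw [integral_finsetSum _ fun k _ => (hint k).const_mul _]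
    refine Finset.sum_congr rfl fun k _ => ?_
    rw [integral_const_mul, mul_assoc, hν]
  rw [← ENNReal.ofReal_sum_of_nonneg fun k _ => by positivity, ← hval]
  exact le_iSup₂ (f := fun (g : Cube d → ℝ) (_ : g ∈ sobolevBall d δ 1) =>
    ENNReal.ofReal (∫ x, (f₁ x - f₂ x) * g x)) _ hmem

/-- The lower bound given by perturbations of the uniform density by `K ^ d` bumps of height
`ε`. -/
theorem le_maximalRisk {n d β δ K : ℕ} (hd : 1 ≤ d) (hK : 1 ≤ K) {R α ε : ℝ} (hε0 : 0 ≤ ε)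
    (hε1 : ε ≤ 1) (hεR : d + ε ^ 2 * (d * ((6 * K : ℕ) : ℝ) ^ (2 * β)) ≤ R ^ 2)
    (hn : n * ((Real.exp α - Real.exp (-α)) * (2 * ε * (1 / (K : ℝ)) ^ d)) ^ 2 ≤ 1 / 2)
    {Z : Type u} [MeasurableSpace Z] (Q : Mechanism n (Cube d) Z) (hQ : Q.IsLDP α)
    (E : Estimator n d Z) :
    ENNReal.ofReal (ε * (1 / (d * ((6 * K : ℕ) : ℝ) ^ δ)) * (1 / 768) ^ d / 4) ≤
      maximalRisk (densities d ∩ sobolevBall d β R) (sobolevBall d δ 1) Q E := by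
  set i₀ : Fin d := ⟨0, hd⟩
  set a : ℝ := 1 / (d * ((6 * K : ℕ) : ℝ) ^ δ) with ha
  have ha0 : 0 ≤ a := by positivity
  have hK0 : (0 : ℝ) < K := by exact_mod_cast hK
  set f : ((Fin d → Fin K) → Bool) → Cube d → ℝ := fun ν x => 1 + ε * signedBumps i₀ ν x with hf
  have hband := isBandLimited_signedBumps hK i₀
  have hfc : ∀ ν, Continuous (f ν) := fun ν => by
    have := (hband ν).continuous
    fun_prop
  have hfd : ∀ ν, f ν ∈ densities d := fun ν => (hband ν).one_add_mem_densities hε0 hε1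
  have hfs : ∀ ν, f ν ∈ sobolevBall d β R := fun ν =>
    (hband ν).affine_mem_sobolevBall (by rwa [one_pow, one_mul])
  have hflip : ∀ k ν x, f (flipBit k ν) x - f ν x =
      -(2 * ε * bitSign (ν k)) * cubeBump i₀ k x := fun k ν x => by
    simp only [hf]
    rw [signedBumps_flipBit]
    ring
  have hprob : ∀ ν, IsProbabilityMeasure (densityLaw (f ν)) := fun ν =>
    isProbabilityMeasure_densityLaw (hfd ν)
  set I : (Fin d → Fin K) → ((Fin d → Fin K) → Bool) → (Fin n → Z) → ℝ := fun k ν z =>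
    ∫ x, (E.toFun z x - f ν x) * cubeBump i₀ k x with hI
  have hmeas : ∀ k ν, Measurable (I k ν) := by
    intro k ν
    have hu : Measurable fun p : (Fin n → Z) × Cube d =>
        (E.toFun p.1 p.2 - f ν p.2) * cubeBump i₀ k p.2 :=
      (E.measurable_uncurry.sub ((hfc ν).measurable.comp measurable_snd)).mul
        ((continuous_cubeBump i₀ k).measurable.comp measurable_snd)
    exact hu.stronglyMeasurable.integral_prod_right'.measurable
  have hD : ∀ k ν z, a * (2 * ε * (1 / (768 * (K : ℝ))) ^ d) ≤
      a * |I k ν z| + a * |I k (flipBit k ν) z| := by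
    intro k ν z
    have hdiff : I k ν z - I k (flipBit k ν) z =
        -(2 * ε * bitSign (ν k)) * ∫ x, cubeBump i₀ k x ^ 2 := by
      simp only [hI]
      rw [← integral_sub (integrable_sub_mul_cubeBump hK i₀ (E.integrable z)
        (hfc ν).integrable_cube k) (integrable_sub_mul_cubeBump hK i₀ (E.integrable z)
        (hfc _).integrable_cube k), ← integral_const_mul]
      congr 1 with x
      rw [← sub_mul, sub_sub_sub_cancel_left, hflip]
      ring
    have habs : |I k ν z - I k (flipBit k ν) z| = 2 * ε * ∫ x, cubeBump i₀ k x ^ 2 := by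
      rw [hdiff, abs_mul, abs_neg, abs_mul, abs_bitSign, mul_one, abs_of_nonneg (by positivity),
        abs_of_nonneg (integral_nonneg fun x => sq_nonneg _)]
    rw [← mul_add]
    refine mul_le_mul_of_nonneg_left ?_ ha0
    calc 2 * ε * (1 / (768 * (K : ℝ))) ^ d ≤ 2 * ε * ∫ x, cubeBump i₀ k x ^ 2 := by
          gcongr; exact le_integral_cubeBump_sq i₀ k
      _ ≤ _ := habs ▸ abs_sub _ _
  have hτ : ∀ k ν, ∫ x, |f (flipBit k ν) x - f ν x| ≤ 2 * ε * (1 / (K : ℝ)) ^ d := by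
    intro k ν
    have : ∀ x, |f (flipBit k ν) x - f ν x| = 2 * ε * |cubeBump i₀ k x| := fun x => by
      rw [hflip, abs_mul, abs_neg, abs_mul, abs_bitSign, mul_one, abs_of_nonneg (by positivity)]
    simp_rw [this]
    rw [integral_const_mul]
    gcongr
    exact integral_abs_cubeBump_le hK i₀ k
  have hmain := card_mul_le_of_flipBit (fun ν => Q.viewLaw (densityLaw (f ν)))
    (fun k ν z => ENNReal.ofReal (a * |I k ν z|))
    (fun k ν => (((hmeas k ν).abs).const_mul a).ennreal_ofReal)
    (D := a * (2 * ε * (1 / (768 * (K : ℝ))) ^ d)) (by positivity)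
    (fun k ν z => by
      rw [← ENNReal.ofReal_add (by positivity) (by positivity)]
      exact ENNReal.ofReal_le_ofReal (hD k ν z))
    (fun k ν B hB => by
      refine Q.sq_viewLaw_le hQ _ _ (fun q hq M hM => ?_) hn hB
      have hM0 : 0 ≤ M := (abs_nonneg _).trans (hM fun _ => 0)
      exact (abs_integral_densityLaw_sub_le (hfd ν) (hfd _) hq hM).trans
        (mul_le_mul_of_nonneg_left (hτ k ν) hM0))
    (ρ := maximalRisk (densities d ∩ sobolevBall d β R) (sobolevBall d δ 1) Q E)
    (fun ν => (lintegral_mono fun z => sum_abs_integral_mul_cubeBump_le_adversarialLoss hK i₀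
      (E.integrable z) (hfc ν).integrable_cube).trans
      (le_iSup₂ (f := fun (f : Cube d → ℝ) (_ : f ∈ densities d ∩ sobolevBall d β R) =>
        ∫⁻ z, adversarialLoss (sobolevBall d δ 1) (E.toFun z) f ∂(Q.viewLaw (densityLaw f)))
        (f ν) ⟨hfd ν, hfs ν⟩))
  refine le_trans (ENNReal.ofReal_le_ofReal (le_of_eq ?_)) hmain
  rw [Fintype.card_fun, Fintype.card_fin, Fintype.card_fin, Nat.cast_pow, one_div_pow,
    one_div_pow, mul_pow]
  field_simp
  ring

theorem exp_sub_exp_neg_le {α A : ℝ} (hα : 0 ≤ α) (hαA : α ≤ A) :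
    Real.exp α - Real.exp (-α) ≤ 2 * α * Real.exp A := by
  have h1 : Real.exp α ≤ Real.exp A := Real.exp_le_exp.mpr hαA
  have h2 := Real.add_one_le_exp (-α)
  have h3 : Real.exp α * Real.exp (-α) = 1 := by rw [← Real.exp_add]; simp
  have h4 : 1 ≤ Real.exp α := Real.one_le_exp hα
  nlinarith [mul_le_mul_of_nonneg_left h2 (Real.exp_pos α).le, mul_le_mul_of_nonneg_left h1 hα]

/-- The lower bound with explicit conditions on the number `K ^ d` of bumps and on their height
`ε`: smoothness asks for `ε K ^ β` to be small, indistinguishability for `n α² ε² K ^ (-2 d)` to be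
small. -/
theorem exists_le_minimaxRisk {d β δ : ℕ} (hd : 1 ≤ d) {R A : ℝ} (hRd : (d : ℝ) < R ^ 2) :
    ∃ c b : ℝ, 0 < c ∧ 0 < b ∧ ∀ (n K : ℕ) (α ε : ℝ), 0 < α → α ≤ A → 1 ≤ K → 0 ≤ ε →
      ε * (K : ℝ) ^ β ≤ b → n * α ^ 2 * ε ^ 2 ≤ b ^ 2 * (K : ℝ) ^ (2 * d) →
      ENNReal.ofReal (c * (ε / (K : ℝ) ^ δ)) ≤
        minimaxRisk.{u} n d (densities d ∩ sobolevBall d β R) (sobolevBall d δ 1) α := by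
  have hd0 : (0 : ℝ) < d := by exact_mod_cast hd
  have hR' : 0 < R ^ 2 - d := by linarith
  -- The three bounds give, in this order, `ε ≤ 1`, membership in the Sobolev ball, and the condition
  -- `n s² ≤ 1 / 2` under which the laws of the views cannot be told apart.
  set b := min 1 (min ((R ^ 2 - d) / (d * 36 ^ β)) (1 / (8 * Real.exp A))) with hb
  have hb0 : 0 < b := by rw [hb]; positivity
  have hb1 : b ≤ 1 := min_le_left _ _
  have hb2 : b ≤ (R ^ 2 - d) / (d * 36 ^ β) := (min_le_right _ _).trans (min_le_left _ _)
  have hb3 : b ≤ 1 / (8 * Real.exp A) := (min_le_right _ _).trans (min_le_right _ _)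
  refine ⟨1 / (d * 6 ^ δ) * (1 / 768) ^ d / 4, b, by positivity, hb0, ?_⟩
  intro n K α ε hα hαA hK hε hεβ hεn
  have hK1 : (1 : ℝ) ≤ K := by exact_mod_cast hK
  have hε1 : ε ≤ 1 := by
    calc ε ≤ ε * (K : ℝ) ^ β := le_mul_of_one_le_right hε (one_le_pow₀ hK1)
      _ ≤ 1 := hεβ.trans hb1
  have hεR : d + ε ^ 2 * (d * ((6 * K : ℕ) : ℝ) ^ (2 * β)) ≤ R ^ 2 := by
    have h1 : ε ^ 2 * (d * ((6 * K : ℕ) : ℝ) ^ (2 * β)) =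
        (ε * (K : ℝ) ^ β) ^ 2 * (d * 36 ^ β) := by
      rw [show (36 : ℝ) = 6 ^ 2 by norm_num, ← pow_mul]
      push_cast
      ring
    have h2 : (ε * (K : ℝ) ^ β) ^ 2 ≤ (R ^ 2 - d) / (d * 36 ^ β) := by
      have h0 : 0 ≤ ε * (K : ℝ) ^ β := by positivity
      nlinarith
    rw [le_div_iff₀ (by positivity)] at h2
    linarith
  have hn : n * ((Real.exp α - Real.exp (-α)) * (2 * ε * (1 / (K : ℝ)) ^ d)) ^ 2 ≤ 1 / 2 := by
    have hexp := exp_sub_exp_neg_le hα.le hαA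
    have hexp0 : 0 ≤ Real.exp α - Real.exp (-α) :=
      sub_nonneg.mpr (Real.exp_le_exp.mpr (by linarith))
    calc n * ((Real.exp α - Real.exp (-α)) * (2 * ε * (1 / (K : ℝ)) ^ d)) ^ 2
        ≤ n * ((2 * α * Real.exp A) * (2 * ε * (1 / (K : ℝ)) ^ d)) ^ 2 := by gcongr
      _ = 16 * Real.exp A ^ 2 * (n * α ^ 2 * ε ^ 2) / (K : ℝ) ^ (2 * d) := by
          rw [one_div_pow, pow_mul']; field_simp; ring
      _ ≤ 16 * Real.exp A ^ 2 * (b ^ 2 * (K : ℝ) ^ (2 * d)) / (K : ℝ) ^ (2 * d) := by gcongr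
      _ = 16 * (b * Real.exp A) ^ 2 := by field_simp
      _ ≤ 16 * (1 / 8) ^ 2 := by
          have : b * Real.exp A ≤ 1 / 8 := by
            calc b * Real.exp A ≤ 1 / (8 * Real.exp A) * Real.exp A := by gcongr
              _ = 1 / 8 := by field_simp
          gcongr
      _ ≤ 1 / 2 := by norm_num
  refine le_iInf fun Z => le_iInf fun _ => le_iInf fun Q => le_iInf fun hQ => le_iInf fun E => ?_
  refine le_trans (ENNReal.ofReal_le_ofReal (le_of_eq ?_))
    (le_maximalRisk (δ := δ) hd hK hε hε1 hεR hn Q hQ E)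
  push_cast
  rw [mul_pow]
  field_simp

theorem theorem1 (d β δ : ℕ) (hd : 1 ≤ d) (hβ : 1 ≤ β) (hδ : 1 ≤ δ)
    (R A : ℝ) (hR : 0 < R) (hRd : (d : ℝ) < R ^ 2) :
    ∃ c : ℝ, 0 < c ∧ ∀ (n : ℕ) (α : ℝ), 0 < α → α ≤ A → 1 ≤ (n : ℝ) * α ^ 2 →
      ENNReal.ofReal
          (c * max (((n : ℝ) * α ^ 2) ^ (-(((β : ℝ) + δ) / (2 * β + 2 * d))))
            (((n : ℝ) * α ^ 2) ^ (-(1 / 2 : ℝ)))) ≤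
        minimaxRisk.{u} n d (densities d ∩ sobolevBall d β R) (sobolevBall d δ 1) α := by
  obtain ⟨c, b, hc, hb, h⟩ := exists_le_minimaxRisk.{u} (β := β) (δ := δ) hd (A := A) hRd
  refine ⟨c * (b / 2 ^ (β + δ)), by positivity, fun n α hα hαA hT => ?_⟩
  set T : ℝ := n * α ^ 2 with hTdef
  have hT0 : 0 < T := by linarith
  rw [mul_max_of_nonneg _ _ (by positivity)]
  rcases max_choice (c * (b / 2 ^ (β + δ)) * T ^ (-(((β : ℝ) + δ) / (2 * β + 2 * d))))
    (c * (b / 2 ^ (β + δ)) * T ^ (-(1 / 2 : ℝ))) with hmax | hmax <;> rw [hmax]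
  -- As many bumps as indistinguishability requires at the greatest height smoothness allows.
  · have hden : (0 : ℝ) < 2 * β + 2 * d := by positivity
    set y : ℝ := T ^ (1 / (2 * (β : ℝ) + 2 * d)) with hy
    have hy1 : 1 ≤ y := Real.one_le_rpow hT (by positivity)
    have hyT : y ^ (2 * β + 2 * d) = T := by
      rw [hy, ← Real.rpow_natCast, ← Real.rpow_mul hT0.le]
      push_cast
      rw [one_div_mul_cancel hden.ne', Real.rpow_one]
    have hyrate : T ^ (-(((β : ℝ) + δ) / (2 * β + 2 * d))) = (y ^ (β + δ))⁻¹ := by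
      rw [Real.rpow_neg hT0.le, hy, ← Real.rpow_natCast, ← Real.rpow_mul hT0.le]
      push_cast
      congr 2
      ring
    have hK : 1 ≤ ⌈y⌉₊ := Nat.one_le_ceil_iff.mpr (by linarith)
    have hKy : y ≤ ⌈y⌉₊ := Nat.le_ceil y
    have hKy2 : (⌈y⌉₊ : ℝ) ≤ 2 * y := by linarith [Nat.ceil_lt_add_one (by linarith : 0 ≤ y)]
    set K := ⌈y⌉₊
    have hK0 : (0 : ℝ) < K := by linarith
    refine le_trans (ENNReal.ofReal_le_ofReal ?_) (h n K α (b / (K : ℝ) ^ β) hα hαA hK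
      (by positivity) (by rw [div_mul_cancel₀ _ (by positivity)]) ?_)
    · rw [hyrate, mul_assoc, div_div, ← pow_add, div_mul_eq_mul_div, ← div_eq_mul_inv, div_div,
        ← mul_pow, mul_comm y]
      gcongr
    · rw [← hTdef, div_pow, mul_div_assoc', div_le_iff₀ (by positivity), ← pow_mul',
        mul_assoc (b ^ 2), ← pow_add, mul_comm T]
      gcongr
      rw [← hyT, add_comm (2 * d)]
      gcongr
  -- A single bump, as high as indistinguishability allows.
  · have hp1 : T ^ (-(1 / 2 : ℝ)) ≤ 1 := Real.rpow_le_one_of_one_le_of_nonpos hT (by norm_num)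
    have hp2 : T * (T ^ (-(1 / 2 : ℝ))) ^ 2 = 1 := by
      rw [← Real.rpow_natCast, ← Real.rpow_mul hT0.le]
      norm_num
      rw [Real.rpow_neg_one, mul_inv_cancel₀ hT0.ne']
    have hp0 : 0 < T ^ (-(1 / 2 : ℝ)) := Real.rpow_pos_of_pos hT0 _
    refine le_trans (ENNReal.ofReal_le_ofReal ?_) (h n 1 α (b * T ^ (-(1 / 2 : ℝ))) hα hαA le_rfl
      (by positivity) ?_ ?_)
    · rw [Nat.cast_one, one_pow, div_one, mul_assoc]
      gcongr
      exact div_le_self hb.le (one_le_pow₀ (by norm_num))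
    · rw [Nat.cast_one, one_pow, mul_one]
      exact mul_le_of_le_one_right hb.le hp1
    · rw [← hTdef, Nat.cast_one, one_pow, mul_one, mul_pow, mul_left_comm, hp2, mul_one]
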